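/- Let $M$ be a smooth (real, finite-dimensional, Hausdorff, second countable) manifold and $L \to M$ a smooth real line bundle. Notation. $DL \to M$ is the Atiyah algebroid of $L$: its sections are the derivations of $L$, i.e. the $\mathbb R$-linear operators $\Delta : \Gamma(L) \to \Gamma(L)$ for which there is a (unique) vector field $\sigma\Delta$, the symbol of $\Delta$, with $\Delta(f\lambda) = (\sigma\Delta)(f)\lambda + f\Delta(\lambda)$; the bracket is the commutator. $J^1L = (DL)^* \otimes L$, with pairing $\langle \Delta, \psi\rangle_L = \psi(\Delta)$. An ($L$-valued) Atiyah $k$-form is a section of $\wedge^k (DL)^* \otimes L$, and $d_{DL}$ is the de Rham differential of $DL$ with coefficients in $L$. For an Atiyah $2$-form $\omega$, $\omega^\flat : DL \to J^1L$ is $\omega^\flat(\Delta) = \omega(\Delta, -)$; for an endomorphism $F$ of $DL$, $F^\dagger : J^1L \to J^1L$ is $F^\dagger\psi = \psi\circ F$. On $\mathbb DL = DL \oplus J^1L$ consider the $L$-valued pairing $\langle\!\langle(\Delta,\phi),(\nabla,\psi)\rangle\!\rangle = \langle\Delta,\psi\rangle_L + \langle\nabla,\phi\rangle_L$ and the bracket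 $[\![(\Delta,\phi),(\nabla,\psi)]\!] = ([\Delta,\nabla], \mathcal L_\Delta\psi - i_\nabla d_{DL}\phi)$. A generalized contact structure on $L$ is a vector bundle endomorphism $\mathcal I$ of $\mathbb DL$ with $\mathcal I^2 = -\mathrm{id}$, skew-symmetric for $\langle\!\langle-,-\rangle\!\rangle$, and such that $[\![\mathcal I\alpha,\mathcal I\beta]\!] - [\![\alpha,\beta]\!] - \mathcal I[\![\mathcal I\alpha,\beta]\!] - \mathcal I[\![\alpha,\mathcal I\beta]\!] = 0$ for all sections $\alpha,\beta$ of $\mathbb DL$. It has the block form $$\mathcal I = \begin{pmatrix} \varphi & J^\sharp \\ \omega^\flat & -\varphi^\dagger\end{pmatrix},$$ with $\varphi$ an endomorphism of $DL$, $\omega$ an Atiyah $2$-form, and $J : \wedge^2 J^1L \to L$ with $\langle J^\sharp\phi,\psi\rangle_L = J(\phi,\psi)$. If $J$ is non-degenerate, i.e. $J^\sharp$ is an isomorphism, $\omega_J = J^{-1}$ denotes the Atiyah $2$-form with $J^\sharp\omega_J^\flat = \mathrm{id}$. A contact structure $H$ with $TM/H = L$ is a maximally non-integrable hyperplane distribution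 $H \subset TM$ with an identification $TM/H = L$; its structure form is the projection $\theta : TM \to TM/H = L$, and it corresponds to the Atiyah $2$-form $\Omega = d_{DL}\sigma^*\theta$, where $\sigma^*\theta(\Delta) = \theta(\sigma\Delta)$. A contact-Hitchin pair on $L$ is a pair $(H,\Phi)$ of a contact structure $H \subset TM$ with $TM/H = L$ and an endomorphism $\Phi$ of $DL$ such that $\Omega^\flat\Phi = \Phi^\dagger\Omega^\flat$ and $d_{DL}\Omega_\Phi = 0$, where $\Omega_\Phi(\Delta,\nabla) = \Omega(\Phi\Delta,\nabla)$. Proposition. There is a one-to-one correspondence between generalized contact structures $\mathcal I$ on $L$ with $J$ non-degenerate and contact-Hitchin pairs $(H,\Phi)$ on $L$. In this correspondence $H$ is the contact structure corresponding to $\omega_J = J^{-1}$, i.e. $d_{DL}\sigma^*\theta = \omega_J$, and moreover $$\Phi = \varphi \quad\text{and}\quad \omega = -(\omega_J + \varphi^*\omega_J), \qquad\text{where } (\varphi^*\omega_J)(\Delta,\nabla) := \omega_J(\varphi\Delta,\varphi\nabla).$$ -/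

import Mathlib

open scoped Manifold ContDiff Bundle
open Bundle VectorField

set_option linter.unusedSectionVars false

namespace GenContact

section Basic

variable {E : Type*} [NormedAddCommGroup E] [NormedSpace ℝ E]
  {M : Type*} [TopologicalSpace M] [ChartedSpace E M]

/-- The ring `C^∞(M)` of smooth real functions on `M`. -/
abbrev SmoothFun (E : Type*) [NormedAddCommGroup E] [NormedSpace ℝ E]
    (M : Type*) [TopologicalSpace M] [ChartedSpace E M] : Type _ :=
  C^∞⟮𝓘(ℝ, E), M; 𝓘(ℝ, ℝ), ℝ⟯

section Module

variable {F : Type*} [NormedAddCommGroup F] [NormedSpace ℝ F]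
  {V : M → Type*} [TopologicalSpace (TotalSpace F V)]
  [∀ x, AddCommGroup (V x)] [∀ x, Module ℝ (V x)] [∀ x, TopologicalSpace (V x)]
  [FiberBundle F V] [VectorBundle ℝ F V]

/-- Pointwise multiplication of smooth sections by smooth functions. -/
noncomputable instance : SMul (SmoothFun E M) (Cₛ^∞⟮𝓘(ℝ, E); F, V⟯) :=
  ⟨fun f s => ⟨fun x => f x • s x, f.contMDiff.smul_section s.contMDiff⟩⟩

theorem fun_smul_apply (f : SmoothFun E M) (s : Cₛ^∞⟮𝓘(ℝ, E); F, V⟯) (x : M) :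
    (f • s) x = f x • s x := rfl

/-- The smooth sections of a vector bundle form a module over `C^∞(M)`. -/
noncomputable instance : Module (SmoothFun E M) (Cₛ^∞⟮𝓘(ℝ, E); F, V⟯) where
  one_smul s := by ext x; exact one_smul ℝ (s x)
  mul_smul f g s := by ext x; exact mul_smul (f x) (g x) (s x)
  smul_zero f := by ext x; exact smul_zero (f x)
  smul_add f s t := by ext x; exact smul_add (f x) (s x) (t x)
  add_smul f g s := by ext x; exact add_smul (f x) (g x) (s x)
  zero_smul s := by ext x; exact zero_smul ℝ (s x)

instance : SMulCommClass ℝ (SmoothFun E M) (Cₛ^∞⟮𝓘(ℝ, E); F, V⟯) where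
  smul_comm r f s := by ext x; exact smul_comm r (f x) (s x)

instance : SMulCommClass (SmoothFun E M) ℝ (Cₛ^∞⟮𝓘(ℝ, E); F, V⟯) where
  smul_comm f r s := by ext x; exact smul_comm (f x) r (s x)

instance : IsScalarTower ℝ (SmoothFun E M) (Cₛ^∞⟮𝓘(ℝ, E); F, V⟯) where
  smul_assoc r f s := by ext x; exact smul_assoc r (f x) (s x)

end Module

variable [IsManifold 𝓘(ℝ, E) ∞ M]

/-- Smooth vector fields on `M`. -/
abbrev VecField (E : Type*) [NormedAddCommGroup E] [NormedSpace ℝ E]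
    (M : Type*) [TopologicalSpace M] [ChartedSpace E M] [IsManifold 𝓘(ℝ, E) ∞ M] : Type _ :=
  Cₛ^∞⟮𝓘(ℝ, E); E, (TangentSpace 𝓘(ℝ, E) : M → Type _)⟯

/-- The derivative `X(f)` of a smooth function `f` along a smooth vector field `X`. -/
noncomputable def VecField.act (X : VecField E M) (f : SmoothFun E M) : SmoothFun E M :=
  ⟨fun x => mvfderiv 𝓘(ℝ, E) f x (X x), by
    have h1 := (f.contMDiff.contMDiff_tangentMap (m := ∞) (by simp)).comp X.contMDiff
    have h2 := (contMDiff_snd_tangentBundle_modelSpace ℝ 𝓘(ℝ, ℝ) (n := ∞)).comp h1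
    exact h2⟩

theorem VecField.act_apply (X : VecField E M) (f : SmoothFun E M) (x : M) :
    X.act f x = mvfderiv 𝓘(ℝ, E) f x (X x) := rfl

theorem VecField.add_act (X Y : VecField E M) (f : SmoothFun E M) :
    (X + Y).act f = X.act f + Y.act f := by
  ext x
  exact map_add (mvfderiv 𝓘(ℝ, E) f x) (X x) (Y x)

theorem VecField.zero_act (f : SmoothFun E M) : (0 : VecField E M).act f = 0 := by
  ext x
  exact map_zero (mvfderiv 𝓘(ℝ, E) f x)

theorem VecField.smul_act (g : SmoothFun E M) (X : VecField E M) (f : SmoothFun E M) :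
    (g • X).act f = g * X.act f := by
  ext x
  exact map_smul (mvfderiv 𝓘(ℝ, E) f x) (g x) (X x)

variable [FiniteDimensional ℝ E]

/-- The Lie bracket of smooth vector fields. -/
noncomputable def VecField.bracket (X Y : VecField E M) : VecField E M :=
  ⟨mlieBracket 𝓘(ℝ, E) X Y, by
    have : CompleteSpace E := FiniteDimensional.complete ℝ E
    have : IsManifold 𝓘(ℝ, E) ((((⊤ : ℕ∞) : ℕ∞ω)) + 1) M := by simpa
    have : IsManifold 𝓘(ℝ, E) (minSmoothness ℝ 2) M := by
      simp only [minSmoothness_of_isRCLikeNormedField]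
      exact IsManifold.of_le (n := ∞) ENat.LEInfty.out
    exact ContDiff.mlieBracket_vectorField (n := ⊤) (m := ⊤) X.contMDiff Y.contMDiff (by simp)⟩

theorem VecField.bracket_apply (X Y : VecField E M) (x : M) :
    X.bracket Y x = mlieBracket 𝓘(ℝ, E) X Y x := rfl

theorem VecField.bracket_smul (X Y : VecField E M) (f : SmoothFun E M) :
    X.bracket (f • Y) = X.act f • Y + f • X.bracket Y := by
  have : CompleteSpace E := FiniteDimensional.complete ℝ E
  ext x
  exact mlieBracket_smul_right f.mdifferentiableAt Y.mdifferentiableAt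

theorem VecField.bracket_swap (X Y : VecField E M) : X.bracket Y = - Y.bracket X := by
  ext x
  exact mlieBracket_swap_apply

theorem VecField.bracket_add (X Y Z : VecField E M) :
    X.bracket (Y + Z) = X.bracket Y + X.bracket Z := by
  have : CompleteSpace E := FiniteDimensional.complete ℝ E
  ext x
  exact mlieBracket_add_right Y.mdifferentiableAt Z.mdifferentiableAt

theorem VecField.leibniz (X Y Z : VecField E M) :
    X.bracket (Y.bracket Z) = (X.bracket Y).bracket Z + Y.bracket (X.bracket Z) := by
  have : CompleteSpace E := FiniteDimensional.complete ℝ E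
  have : IsManifold 𝓘(ℝ, E) (minSmoothness ℝ 3) M := by
    simp only [minSmoothness_of_isRCLikeNormedField]
    exact IsManifold.of_le (n := ∞) ENat.LEInfty.out
  have h : ∀ (W : VecField E M) (x : M),
      ContMDiffAt 𝓘(ℝ, E) (𝓘(ℝ, E).prod 𝓘(ℝ, E)) (minSmoothness ℝ 2)
        (fun x => TotalSpace.mk' E x (W x)) x := fun W x => by
    simp only [minSmoothness_of_isRCLikeNormedField]
    exact (W.contMDiff x).of_le ENat.LEInfty.out
  ext x
  exact leibniz_identity_mlieBracket_apply (h X x) (h Y x) (h Z x)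

/-- The Lie bracket of vector fields acts on functions as the commutator. -/
theorem VecField.bracket_act (X Y : VecField E M) (f : SmoothFun E M) :
    (X.bracket Y).act f = X.act (Y.act f) - Y.act (X.act f) := by
  have key : ∀ Z : VecField E M,
      (X.bracket Y).act f • Z = (X.act (Y.act f) - Y.act (X.act f)) • Z := by
    intro Z
    have h := VecField.leibniz X Y (f • Z)
    have h0 := VecField.leibniz X Y Z
    simp only [VecField.bracket_smul, VecField.bracket_add] at h
    rw [h0] at h
    rw [sub_smul]
    rw [smul_add] at h
    have e : ∀ a b c d k l m n p : VecField E M,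
      a + b + (c + (k + l)) = d + (k) + (m + c + (b + l)) → d = a - m := by
      intro a b c d k l m n p hh
      have : d = a - m + ((d + k + (m + c + (b + l))) - (a + b + (c + (k + l)))) := by abel
      rw [this, hh]; abel
    exact e _ _ _ _ _ _ _ 0 0 h
  ext x
  have hx : ∀ Z : VecField E M, Z x ≠ 0 →
      (X.bracket Y).act f x = (X.act (Y.act f) - Y.act (X.act f)) x := by
    intro Z hZ
    have := congrArg (fun W : VecField E M => W x) (key Z)
    exact smul_left_injective ℝ hZ this
  by_cases hX : X x = 0
  · by_cases hY : Y x = 0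
    · have hb : X.bracket Y x = 0 := by
        rw [VecField.bracket_apply, ← mlieBracketWithin_univ]
        exact mlieBracketWithin_eq_zero_of_eq_zero hX hY
      change mvfderiv 𝓘(ℝ, E) f x (X.bracket Y x)
        = mvfderiv 𝓘(ℝ, E) (Y.act f) x (X x) - mvfderiv 𝓘(ℝ, E) (X.act f) x (Y x)
      rw [hb, hX, hY]; simp
    · exact hx Y hY
  · exact hx X hX


end Basic

section LineBundle

variable (E : Type*) [NormedAddCommGroup E] [NormedSpace ℝ E] [FiniteDimensional ℝ E]
  {M : Type*} [TopologicalSpace M] [ChartedSpace E M] [IsManifold 𝓘(ℝ, E) ∞ M]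
  (L : M → Type*) [TopologicalSpace (TotalSpace ℝ L)]
  [∀ x, AddCommGroup (L x)] [∀ x, Module ℝ (L x)] [∀ x, TopologicalSpace (L x)]
  [FiberBundle ℝ L] [VectorBundle ℝ ℝ L]

/-- `Γ(L)`: smooth sections of the line bundle `L`. -/
abbrev Sec : Type _ := Cₛ^∞⟮𝓘(ℝ, E); ℝ, L⟯

/-- The `C^∞(M)`-module `Γ(DL)` of derivations of `L`: `ℝ`-linear operators `Δ` on `Γ(L)`,
together with their symbol `X = σΔ`, such that `Δ(f s) = X(f) s + f Δ(s)`.  As `L` has rank one,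
`X` is determined by `Δ`, so that a pair `(Δ, X)` is the same thing as a derivation `Δ`. -/
def derivations : Submodule (SmoothFun E M) ((Sec E L →ₗ[ℝ] Sec E L) × VecField E M) where
  carrier := {D | ∀ (f : SmoothFun E M) (s : Sec E L),
    D.1 (f • s) = D.2.act f • s + f • D.1 s}
  add_mem' {D D'} h h' f s := by
    have e1 := h f s
    have e2 := h' f s
    simp only [Prod.fst_add, Prod.snd_add, LinearMap.add_apply, VecField.add_act, add_smul,
      smul_add, e1, e2]
    abel
  zero_mem' f s := by simp [VecField.zero_act]
  smul_mem' g D h f s := by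
    have e1 := h f s
    simp only [Prod.smul_fst, Prod.smul_snd, LinearMap.smul_apply, VecField.smul_act, e1,
      smul_add, smul_smul, mul_comm f g]

/-- `Γ(DL)`, the sections of the Atiyah algebroid of `L`. -/
abbrev DL : Type _ := derivations E L

/-- `Γ(J¹L)`, where `J¹L = (DL)* ⊗ L`; these are also the `L`-valued Atiyah `1`-forms. -/
abbrev J1 : Type _ := DL E L →ₗ[SmoothFun E M] Sec E L

/-- `Γ(𝔻L)`, where `𝔻L = DL ⊕ J¹L` is the omni-Lie algebroid of `L`. -/
abbrev OmniDL : Type _ := DL E L × J1 E L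

variable {E L}

namespace DL

/-- The action of a derivation on a section, i.e. the tautological representation. -/
def app (D : DL E L) : Sec E L →ₗ[ℝ] Sec E L := D.1.1

/-- The symbol of a derivation. -/
def symbol (D : DL E L) : VecField E M := D.1.2

theorem app_smul (D : DL E L) (f : SmoothFun E M) (s : Sec E L) :
    D.app (f • s) = D.symbol.act f • s + f • D.app s := D.2 f s

theorem add_app (D D' : DL E L) (s : Sec E L) : (D + D').app s = D.app s + D'.app s := rfl

theorem smul_app (f : SmoothFun E M) (D : DL E L) (s : Sec E L) :
    (f • D).app s = f • D.app s := rfl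

theorem symbol_add (D D' : DL E L) : (D + D').symbol = D.symbol + D'.symbol := rfl

theorem symbol_smul (f : SmoothFun E M) (D : DL E L) : (f • D).symbol = f • D.symbol := rfl

theorem ext' {D D' : DL E L} (h : ∀ s, D.app s = D'.app s) (h' : D.symbol = D'.symbol) :
    D = D' :=
  Subtype.ext (Prod.ext (LinearMap.ext h) h')

/-- The Lie bracket of `DL`: the commutator of derivations. -/
noncomputable def bracket (D D' : DL E L) : DL E L :=
  ⟨(D.app ∘ₗ D'.app - D'.app ∘ₗ D.app, D.symbol.bracket D'.symbol), by
    intro f s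
    simp only [LinearMap.sub_apply, LinearMap.comp_apply, app_smul, map_add,
      VecField.bracket_act, sub_smul, smul_sub]
    abel⟩

theorem bracket_app (D D' : DL E L) (s : Sec E L) :
    (D.bracket D').app s = D.app (D'.app s) - D'.app (D.app s) := rfl

theorem symbol_bracket (D D' : DL E L) :
    (D.bracket D').symbol = D.symbol.bracket D'.symbol := rfl

theorem bracket_swap (D D' : DL E L) : D.bracket D' = -D'.bracket D := by
  refine ext' (fun s => ?_) (VecField.bracket_swap _ _)
  change (D.bracket D').app s = -((D'.bracket D).app s)
  rw [bracket_app, bracket_app, neg_sub]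

theorem bracket_add (D D₁ D₂ : DL E L) :
    D.bracket (D₁ + D₂) = D.bracket D₁ + D.bracket D₂ := by
  refine ext' (fun s => ?_) (VecField.bracket_add _ _ _)
  simp only [bracket_app, add_app, map_add]
  abel

theorem bracket_smul (D D' : DL E L) (f : SmoothFun E M) :
    D.bracket (f • D') = D.symbol.act f • D' + f • D.bracket D' := by
  refine ext' (fun s => ?_) (VecField.bracket_smul _ _ _)
  simp only [bracket_app, add_app, smul_app, app_smul, smul_sub]
  abel

end DL

/-- `⟨φ, Δ⟩_L`-adjoint: `F† φ = φ ∘ F`, for an endomorphism `F` of `DL`. -/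
noncomputable def dagger (F : DL E L →ₗ[SmoothFun E M] DL E L) : J1 E L →ₗ[SmoothFun E M] J1 E L :=
  LinearMap.lcomp (SmoothFun E M) (Sec E L) F

theorem dagger_apply (F : DL E L →ₗ[SmoothFun E M] DL E L) (φ : J1 E L) (D : DL E L) :
    dagger F φ D = φ (F D) := rfl

variable (E L) in
/-- `L`-valued Atiyah `2`-forms `ω`, recorded through `ω♭ : DL → J¹L`, `ω♭(Δ) = ω(Δ, -)`. -/
@[ext]
structure AtiyahTwoForm where
  flat : DL E L →ₗ[SmoothFun E M] J1 E L
  alt : ∀ D, flat D D = 0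

/-- A section which equals its opposite vanishes. -/
theorem sec_eq_zero_of_eq_neg {s : Sec E L} (h : s = -s) : s = 0 := by
  ext x
  have hx : s x = -(s x) := congrArg (fun t : Sec E L => t x) h
  have h2 : (2 : ℝ) • s x = 0 := by
    rw [two_smul]
    nth_rewrite 1 [hx]
    exact neg_add_cancel (s x)
  exact (smul_eq_zero.mp h2).resolve_left two_ne_zero

theorem AtiyahTwoForm.skew (w : AtiyahTwoForm E L) (D D' : DL E L) :
    w.flat D D' = -w.flat D' D := by
  have h := w.alt (D + D')
  simp only [map_add, LinearMap.add_apply, w.alt, zero_add, add_zero] at h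
  exact eq_neg_of_add_eq_zero_right h

/-- The differential `d_{DL}` of an Atiyah `1`-form. -/
noncomputable def dOne (φ : J1 E L) : AtiyahTwoForm E L where
  flat := LinearMap.mk₂ (SmoothFun E M)
    (fun D D' => D.app (φ D') - D'.app (φ D) - φ (D.bracket D'))
    (fun D₁ D₂ D' => by
      rw [DL.bracket_swap, DL.bracket_add, DL.bracket_swap D₁, DL.bracket_swap D₂]
      simp only [DL.add_app, map_add, map_neg]
      abel)
    (fun f D D' => by
      rw [DL.bracket_swap, DL.bracket_smul, DL.bracket_swap D]
      simp only [DL.smul_app, map_smul, DL.app_smul, map_add, map_neg, smul_sub, smul_neg]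
      abel)
    (fun D D₁ D₂ => by
      simp only [DL.bracket_add, DL.add_app, map_add]
      abel)
    (fun f D D' => by
      simp only [DL.bracket_smul, DL.smul_app, map_smul, DL.app_smul, map_add, smul_sub]
      abel)
  alt D := by
    have h : D.bracket D = 0 :=
      DL.ext' (fun s => sub_self _) (by
        ext x
        exact congrFun (mlieBracket_self (I := 𝓘(ℝ, E)) (V := D.symbol)) x)
    simp [h]

theorem dOne_apply (φ : J1 E L) (D D' : DL E L) :
    (dOne φ).flat D D' = D.app (φ D') - D'.app (φ D) - φ (D.bracket D') := rfl

/-- The differential `d_{DL}` of an Atiyah `2`-form, evaluated on three derivations. -/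
noncomputable def dTwo (w : AtiyahTwoForm E L) (D₁ D₂ D₃ : DL E L) : Sec E L :=
  D₁.app (w.flat D₂ D₃) - D₂.app (w.flat D₁ D₃) + D₃.app (w.flat D₁ D₂)
    - w.flat (D₁.bracket D₂) D₃ + w.flat (D₁.bracket D₃) D₂ - w.flat (D₂.bracket D₃) D₁

/-- The Lie derivative `ℒ_Δ ψ` of a section of `J¹L`. -/
noncomputable def lieDeriv (D : DL E L) (ψ : J1 E L) : J1 E L where
  toFun D' := D.app (ψ D') - ψ (D.bracket D')
  map_add' D₁ D₂ := by
    simp only [DL.bracket_add, map_add]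
    abel
  map_smul' f D' := by
    simp only [DL.bracket_smul, map_smul, DL.app_smul, map_add, smul_sub, RingHom.id_apply]
    abel

/-- The `L`-valued symmetric pairing on `𝔻L`. -/
noncomputable def pairing (α β : OmniDL E L) : Sec E L := β.2 α.1 + α.2 β.1

/-- The Dorfman-Jacobi bracket `([Δ, ∇], ℒ_Δ ψ - i_∇ d φ)` on `𝔻L`. -/
noncomputable def dorfman (α β : OmniDL E L) : OmniDL E L :=
  (α.1.bracket β.1, lieDeriv α.1 β.2 - (dOne α.2).flat β.1)

variable (E L) in
/-- Generalized contact structures on `L`: integrable generalized almost contact structures. -/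
@[ext]
structure GenContactStructure where
  /-- the endomorphism `ℐ` of `𝔻L` -/
  endo : OmniDL E L →ₗ[SmoothFun E M] OmniDL E L
  sq : ∀ α, endo (endo α) = -α
  skew : ∀ α β, pairing (endo α) β = -pairing α (endo β)
  integrable : ∀ α β, dorfman (endo α) (endo β) - dorfman α β
    - endo (dorfman (endo α) β) - endo (dorfman α (endo β)) = 0

namespace GenContactStructure

/-- The component `φ : DL → DL`. -/
noncomputable def phi (I : GenContactStructure E L) : DL E L →ₗ[SmoothFun E M] DL E L :=
  LinearMap.fst _ _ _ ∘ₗ I.endo ∘ₗ LinearMap.inl _ _ _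

/-- The component `J♯ : J¹L → DL`; the `2`-form `J` is `J(φ, ψ) = ⟨J♯ φ, ψ⟩_L`. -/
noncomputable def sharp (I : GenContactStructure E L) : J1 E L →ₗ[SmoothFun E M] DL E L :=
  LinearMap.fst _ _ _ ∘ₗ I.endo ∘ₗ LinearMap.inr _ _ _

/-- The component `ω`, with `ω♭ : DL → J¹L`. -/
noncomputable def omega (I : GenContactStructure E L) : AtiyahTwoForm E L where
  flat := LinearMap.snd _ _ _ ∘ₗ I.endo ∘ₗ LinearMap.inl _ _ _
  alt D := by
    have h := I.skew (D, 0) (D, 0)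
    simp only [pairing, LinearMap.zero_apply, zero_add, add_zero] at h
    exact sec_eq_zero_of_eq_neg h

theorem sharp_skew (I : GenContactStructure E L) (φ ψ : J1 E L) :
    ψ (I.sharp φ) = -φ (I.sharp ψ) := by
  have h := I.skew (0, φ) (0, ψ)
  simp only [pairing, map_zero, zero_add, add_zero] at h
  exact h

/-- The block form of `ℐ`, with entries `φ`, `J♯`, `ω♭`, `-φ†`. -/
theorem endo_apply (I : GenContactStructure E L) (D : DL E L) (ψ : J1 E L) :
    I.endo (D, ψ) = (I.phi D + I.sharp ψ, I.omega.flat D - dagger I.phi ψ) := by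
  have h0 : I.endo (D, ψ) = I.endo (D, 0) + I.endo (0, ψ) := by
    rw [← map_add]; simp
  have h1 : (I.endo (0, ψ)).2 = -dagger I.phi ψ := by
    ext1 D'
    have h := I.skew (0, ψ) (D', 0)
    simp only [pairing, LinearMap.zero_apply, map_zero, zero_add] at h
    exact h
  rw [h0]
  refine Prod.ext rfl ?_
  rw [Prod.snd_add, h1, ← sub_eq_add_neg]
  rfl

/-- `J` is non-degenerate: `J♯ : J¹L → DL` is an isomorphism. -/
def NonDegenerate (I : GenContactStructure E L) : Prop := Function.Bijective I.sharp

/-- The Atiyah `2`-form `ω_J = J⁻¹`, characterized by `J♯ ∘ ω_J♭ = id`. -/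
noncomputable def omegaJ (I : GenContactStructure E L) (h : I.NonDegenerate) :
    AtiyahTwoForm E L where
  flat := (LinearEquiv.ofBijective I.sharp h).symm.toLinearMap
  alt D := by
    obtain ⟨ψ, rfl⟩ := h.2 D
    have e : (LinearEquiv.ofBijective I.sharp h).symm (I.sharp ψ) = ψ :=
      (LinearEquiv.ofBijective I.sharp h).symm_apply_apply ψ
    change (LinearEquiv.ofBijective I.sharp h).symm (I.sharp ψ) (I.sharp ψ) = 0
    rw [e]
    exact sec_eq_zero_of_eq_neg (I.sharp_skew ψ ψ)

theorem sharp_omegaJ (I : GenContactStructure E L) (h : I.NonDegenerate) (D : DL E L) :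
    I.sharp ((I.omegaJ h).flat D) = D :=
  (LinearEquiv.ofBijective I.sharp h).apply_symm_apply D

end GenContactStructure

variable (E L) in
/-- Contact structures `H ⊂ TM` with `TM/H = L`: a field `H` of hyperplanes, with a smooth
`L`-valued `1`-form `θ` (the structure form) of kernel `H` which identifies `TM/H` with `L`, such
that `H` is maximally non-integrable, i.e. the curvature form
`H × H → TM/H`, `(X, Y) ↦ [X, Y] mod H`, is non-degenerate. -/
@[ext]
structure ContactStructure where
  H : ∀ x : M, Submodule ℝ (TangentSpace 𝓘(ℝ, E) x)
  θ : ∀ x : M, TangentSpace 𝓘(ℝ, E) x →ₗ[ℝ] L x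
  smooth : ∀ X : VecField E M, ContMDiff 𝓘(ℝ, E) (𝓘(ℝ, E).prod 𝓘(ℝ, ℝ)) ∞
    (fun x => TotalSpace.mk' ℝ x (θ x (X x)))
  ker_eq : ∀ x, LinearMap.ker (θ x) = H x
  surjective : ∀ x, Function.Surjective (θ x)
  nonintegrable : ∀ X : VecField E M, (∀ y, X y ∈ H y) → ∀ x,
    (∀ Y : VecField E M, (∀ y, Y y ∈ H y) → θ x (X.bracket Y x) = 0) → X x = 0

namespace ContactStructure

/-- `σ*θ`, i.e. `(σ*θ)(Δ) = θ(σΔ)`. -/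
noncomputable def pullbackθ (C : ContactStructure E L) : J1 E L where
  toFun D := ⟨fun x => C.θ x (D.symbol x), C.smooth D.symbol⟩
  map_add' D D' := by
    ext x
    exact map_add (C.θ x) (D.symbol x) (D'.symbol x)
  map_smul' f D := by
    ext x
    exact map_smul (C.θ x) (f x) (D.symbol x)

/-- The Atiyah `2`-form `d_{DL}(σ*θ)` corresponding to a contact structure. -/
noncomputable def form (C : ContactStructure E L) : AtiyahTwoForm E L := dOne C.pullbackθ

end ContactStructure

/-- `Ω_Φ(Δ, ∇) = Ω(ΦΔ, ∇)`, for `Φ` with `Ω♭ Φ = Φ† Ω♭`. -/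
noncomputable def AtiyahTwoForm.twist (Ω : AtiyahTwoForm E L) (Φ : DL E L →ₗ[SmoothFun E M] DL E L)
    (h : Ω.flat ∘ₗ Φ = dagger Φ ∘ₗ Ω.flat) : AtiyahTwoForm E L where
  flat := Ω.flat ∘ₗ Φ
  alt D := by
    have e : Ω.flat (Φ D) D = Ω.flat D (Φ D) :=
      congrArg (fun F : DL E L →ₗ[SmoothFun E M] J1 E L => F D D) h
    exact sec_eq_zero_of_eq_neg (e.trans (Ω.skew D (Φ D)))

variable (E L) in
/-- Contact-Hitchin pairs `(H, Φ)` on `L`. -/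
@[ext]
structure ContactHitchinPair where
  contact : ContactStructure E L
  Φ : DL E L →ₗ[SmoothFun E M] DL E L
  compat : contact.form.flat ∘ₗ Φ = dagger Φ ∘ₗ contact.form.flat
  closed : ∀ D₁ D₂ D₃, dTwo (contact.form.twist Φ compat) D₁ D₂ D₃ = 0

end LineBundle

end GenContact

/-! Write `𝟙` for the identity derivation and `ω_J` for the inverse of `J`. Blockwise, `ℐ² = -id`
says that `ω_J` intertwines `φ` with `φ†` and that `J♯ ω♭ = -(id + φ²)`. So `ℐ` is determined by
`(ω_J, φ)`, and `ω = -(ω_J + φ*ω_J)`.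

Integrability: `ℐ` carries `J¹L` onto the graph of `-(ω_J)_φ`, which is complementary to `J¹L`. The
torsion is biadditive and `ℐ`-antilinear in each slot, so it vanishes once it vanishes on this
graph. There it equals `ι d(ω_J)_φ + ℐ(ι dω_J)`, whose two terms lie in `J¹L` and `ℐ(J¹L)`. Hence
`ℐ` is integrable iff `ω_J` and `(ω_J)_φ` are closed (`torsion_eq_zero_iff`).

Contact geometry: `𝟙` is central and acts as the identity, so a closed form `w` equals `dη` with `η
= ι_𝟙 w` (`AtiyahTwoForm.eq_dOne`). As `η(𝟙) = 0` and `𝟙` spans the kernel of the symbol at each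
point, `η = σ*θ`. On `ker η` the form `dη` is minus the curvature of `ker θ`, while `dη(𝟙, -) = η`.
Thus nondegeneracy of `dη` amounts to the contact condition (`exists_contactStructure`,
`bijective_form_flat`).

Forms are `C^∞(M)`-linear maps on global sections, so pointwise arguments go through cut-off frames.
Inverting a pointwise nondegenerate form uses Cramer's rule near each point, followed by gluing. -/

namespace GenContact

/-! ### Cut-off local frames of vector bundles -/

section Frames

variable {E : Type*} [NormedAddCommGroup E] [NormedSpace ℝ E]
  {M : Type*} [TopologicalSpace M] [ChartedSpace E M]

section Eval

variable {F : Type*} [NormedAddCommGroup F] [NormedSpace ℝ F]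
  {V : M → Type*} [TopologicalSpace (TotalSpace F V)]
  [∀ x, AddCommGroup (V x)] [∀ x, Module ℝ (V x)] [∀ x, TopologicalSpace (V x)]
  [FiberBundle F V] [VectorBundle ℝ F V]

/-- Evaluation of smooth sections at a point. -/
noncomputable def secEval (V : M → Type*) [TopologicalSpace (TotalSpace F V)]
    [∀ x, AddCommGroup (V x)] [∀ x, Module ℝ (V x)] [∀ x, TopologicalSpace (V x)]
    [FiberBundle F V] [VectorBundle ℝ F V] (x : M) : Cₛ^∞⟮𝓘(ℝ, E); F, V⟯ →ₗ[ℝ] V x where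
  toFun s := s x
  map_add' _ _ := rfl
  map_smul' _ _ := rfl

theorem sum_section_apply {ι : Type*} (A : Finset ι) (s : ι → Cₛ^∞⟮𝓘(ℝ, E); F, V⟯) (x : M) :
    (∑ i ∈ A, s i) x = ∑ i ∈ A, s i x := map_sum (secEval V x) s A

theorem sum_fun_apply {ι : Type*} (A : Finset ι) (f : ι → SmoothFun E M) (x : M) :
    (∑ i ∈ A, f i) x = ∑ i ∈ A, f i x :=
  map_sum (ContMDiffMap.evalRingHom (I := 𝓘(ℝ, E)) (n := ∞) (R := ℝ) x) f A

end Eval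

variable [FiniteDimensional ℝ E] [T2Space M] [IsManifold 𝓘(ℝ, E) ∞ M]

/-- Smooth cutoff functions: near any point there is one supported in a given neighbourhood. -/
theorem exists_cutoff (x₀ : M) {u : Set M} (hu : u ∈ nhds x₀) :
    ∃ χ : SmoothFun E M, (∀ᶠ y in nhds x₀, χ y = 1) ∧ tsupport χ ⊆ u := by
  obtain ⟨χ, hχ, -⟩ := (SmoothBumpFunction.nhds_basis_support (I := 𝓘(ℝ, E)) hu).mem_iff.1 hu
  exact ⟨⟨χ, χ.contMDiff⟩, χ.eventuallyEq_one, hχ⟩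

variable {F : Type*} [NormedAddCommGroup F] [NormedSpace ℝ F] [FiniteDimensional ℝ F]
  (V : M → Type*) [TopologicalSpace (TotalSpace F V)]
  [∀ x, AddCommGroup (V x)] [∀ x, Module ℝ (V x)] [∀ x, TopologicalSpace (V x)]
  [FiberBundle F V] [VectorBundle ℝ F V] [ContMDiffVectorBundle ∞ F V 𝓘(ℝ, E)]

/-- A cut-off local frame `t` around `x₀`, with globally defined coefficient functionals `c`. -/
theorem exists_smooth_frame {ι : Type*} [Fintype ι] [DecidableEq ι] (b : Module.Basis ι ℝ F)
    (x₀ : M) :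
    ∃ (ρ : SmoothFun E M)
      (c : ι → Cₛ^∞⟮𝓘(ℝ, E); F, V⟯ →ₗ[SmoothFun E M] SmoothFun E M)
      (t : ι → Cₛ^∞⟮𝓘(ℝ, E); F, V⟯),
      (∀ᶠ y in nhds x₀, ρ y = 1) ∧ (∀ s, ∑ i, c i s • t i = ρ • s) ∧
      (∀ i j, c i (t j) x₀ = if i = j then 1 else 0) ∧ ∀ i s, s x₀ = 0 → c i s x₀ = 0 := by
  have : ContMDiffVectorBundle 1 F V 𝓘(ℝ, E) := ContMDiffVectorBundle.of_le (n := ∞) (by simp)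
  let e := trivializationAt F V x₀
  have hx₀ : x₀ ∈ e.baseSet := FiberBundle.mem_baseSet_trivializationAt' x₀
  obtain ⟨χ, h1, hχ⟩ := exists_cutoff (E := E) x₀ (e.open_baseSet.mem_nhds hx₀)
  have hcoeff : ∀ (i : ι) (s : Cₛ^∞⟮𝓘(ℝ, E); F, V⟯), ContMDiff 𝓘(ℝ, E) 𝓘(ℝ, ℝ) ∞
      (fun y => χ y * e.localFrameCoeff 𝓘(ℝ, E) b i y (s y)) := by
    intro i s
    refine contMDiff_of_tsupport fun x hx => ?_
    have hx' : x ∈ e.baseSet := hχ (tsupport_mul_subset_left hx)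
    exact (χ.contMDiff x).mul (contMDiffAt_localFrameCoeff b hx' (s.contMDiff x) i)
  -- One factor `χ` makes the coefficients global, the other the frame, so a section is recovered up
  -- to `χ²`.
  refine ⟨χ * χ, fun i =>
    { toFun := fun s => ⟨_, hcoeff i s⟩
      map_add' := fun s s' => ?_
      map_smul' := fun f s => ?_ },
    fun i => ⟨(χ : M → ℝ) • e.localFrame b i, ContMDiffOn.smul_section_of_tsupport
      χ.contMDiff.contMDiffOn e.open_baseSet hχ (e.contMDiffOn_localFrame_baseSet _ b i)⟩,
    ?_, ?_, ?_, ?_⟩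
  · ext y
    change χ y * e.localFrameCoeff 𝓘(ℝ, E) b i y (s y + s' y) = χ y * _ + χ y * _
    rw [map_add, mul_add]
  · ext y
    change χ y * e.localFrameCoeff 𝓘(ℝ, E) b i y (f y • s y) = f y * (χ y * _)
    rw [map_smul, smul_eq_mul, mul_left_comm]
  · filter_upwards [h1] with y hy
    change χ y * χ y = 1
    rw [hy, one_mul]
  · intro s
    ext y
    rw [sum_section_apply]
    change ∑ i, (χ y * e.localFrameCoeff 𝓘(ℝ, E) b i y (s y)) • (χ y • e.localFrame b i y)
      = (χ y * χ y) • s y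
    by_cases hy : y ∈ e.baseSet
    · conv_rhs => rw [e.eq_sum_localFrameCoeff_smul (I := 𝓘(ℝ, E)) (b := b) (s := s) hy]
      rw [Finset.smul_sum]
      exact Finset.sum_congr rfl fun i _ => by simp only [smul_smul]; congr 1; ring
    · have : χ y = 0 := image_eq_zero_of_notMem_tsupport fun h => hy (hχ h)
      simp [this]
  · intro i j
    change χ x₀ * e.localFrameCoeff 𝓘(ℝ, E) b i x₀ (χ x₀ • e.localFrame b j x₀) = _
    rw [h1.self_of_nhds, one_smul, one_mul, e.localFrameCoeff_apply_of_mem_baseSet b hx₀,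
      e.localFrame_apply_of_mem_baseSet b hx₀, Module.Basis.repr_self, Finsupp.single_apply]
    simp only [eq_comm]
  · intro i s hs
    change χ x₀ * e.localFrameCoeff 𝓘(ℝ, E) b i x₀ (s x₀) = 0
    rw [hs, map_zero, mul_zero]

/-- Every vector of a fibre extends to a smooth section. -/
theorem exists_section_eq (x₀ : M) (v : V x₀) : ∃ s : Cₛ^∞⟮𝓘(ℝ, E); F, V⟯, s x₀ = v := by
  let e := trivializationAt F V x₀
  have hx₀ : x₀ ∈ e.baseSet := FiberBundle.mem_baseSet_trivializationAt' x₀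
  obtain ⟨χ, h1, hχ⟩ := exists_cutoff (E := E) x₀ (e.open_baseSet.mem_nhds hx₀)
  let b := Module.finBasis ℝ F
  have hs := fun i => ContMDiffOn.smul_section_of_tsupport
      χ.contMDiff.contMDiffOn e.open_baseSet hχ (e.contMDiffOn_localFrame_baseSet (I := 𝓘(ℝ, E)) ∞ b i)
  refine ⟨∑ i, (e.basisAt b hx₀).repr v i • ⟨_, hs i⟩, ?_⟩
  rw [sum_section_apply]
  conv_rhs => rw [← (e.basisAt b hx₀).sum_repr v]
  refine Finset.sum_congr rfl fun i _ => ?_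
  change (e.basisAt b hx₀).repr v i • (χ x₀ • e.localFrame b i x₀) = _
  rw [h1.self_of_nhds, one_smul, e.localFrame_apply_of_mem_baseSet b hx₀]

end Frames

/-! ### Dorfman bracket, torsion and the de Rham differential -/

section OmniAlgebra

variable {E : Type*} [NormedAddCommGroup E] [NormedSpace ℝ E] [FiniteDimensional ℝ E]
  {M : Type*} [TopologicalSpace M] [ChartedSpace E M] [IsManifold 𝓘(ℝ, E) ∞ M]
  {L : M → Type*} [TopologicalSpace (TotalSpace ℝ L)]
  [∀ x, AddCommGroup (L x)] [∀ x, Module ℝ (L x)] [∀ x, TopologicalSpace (L x)]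
  [FiberBundle ℝ L] [VectorBundle ℝ ℝ L]

theorem DL.add_bracket (D₁ D₂ D : DL E L) :
    (D₁ + D₂).bracket D = D₁.bracket D + D₂.bracket D := by
  rw [DL.bracket_swap, DL.bracket_add, neg_add, ← DL.bracket_swap, ← DL.bracket_swap]

theorem DL.bracket_zero (D : DL E L) : D.bracket 0 = 0 :=
  map_zero (AddMonoidHom.mk' D.bracket (DL.bracket_add D))

theorem DL.zero_bracket (D : DL E L) : (0 : DL E L).bracket D = 0 := by
  rw [DL.bracket_swap, DL.bracket_zero, neg_zero]

theorem DL.zero_app (s : Sec E L) : (0 : DL E L).app s = 0 := rfl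

theorem lieDeriv_apply (D D' : DL E L) (ψ : J1 E L) :
    lieDeriv D ψ D' = D.app (ψ D') - ψ (D.bracket D') := rfl

theorem dorfman_add_left (α α' β : OmniDL E L) :
    dorfman (α + α') β = dorfman α β + dorfman α' β := by
  refine Prod.ext (DL.add_bracket _ _ _) (LinearMap.ext fun D => ?_)
  simp only [dorfman, Prod.fst_add, Prod.snd_add, LinearMap.add_apply, LinearMap.sub_apply,
    lieDeriv_apply, dOne_apply, DL.add_bracket, DL.add_app, map_add]
  abel

theorem dorfman_add_right (α β β' : OmniDL E L) :
    dorfman α (β + β') = dorfman α β + dorfman α β' := by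
  refine Prod.ext (DL.bracket_add _ _ _) (LinearMap.ext fun D => ?_)
  simp only [dorfman, Prod.fst_add, Prod.snd_add, LinearMap.add_apply, LinearMap.sub_apply,
    lieDeriv_apply, dOne_apply, map_add]
  abel

theorem dorfman_neg_left (α β : OmniDL E L) : dorfman (-α) β = -dorfman α β :=
  map_neg (AddMonoidHom.mk' (fun α => dorfman α β) fun α α' => dorfman_add_left α α' β) α

theorem dorfman_neg_right (α β : OmniDL E L) : dorfman α (-β) = -dorfman α β :=
  map_neg (AddMonoidHom.mk' (dorfman α) (dorfman_add_right α)) β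

/-- The Nijenhuis torsion of an endomorphism of the omni-Lie algebroid. -/
noncomputable def torsion (I : OmniDL E L →ₗ[SmoothFun E M] OmniDL E L) (α β : OmniDL E L) :
    OmniDL E L :=
  dorfman (I α) (I β) - dorfman α β - I (dorfman (I α) β) - I (dorfman α (I β))

variable {I : OmniDL E L →ₗ[SmoothFun E M] OmniDL E L}

theorem torsion_add_left (α α' β : OmniDL E L) :
    torsion I (α + α') β = torsion I α β + torsion I α' β := by
  simp only [torsion, map_add, dorfman_add_left]
  abel

theorem torsion_add_right (α β β' : OmniDL E L) :
    torsion I α (β + β') = torsion I α β + torsion I α β' := by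
  simp only [torsion, map_add, dorfman_add_right]
  abel

/-- Together with biadditivity, antilinearity reduces vanishing of the torsion to any subset that
spans along with its image under `I`. -/
theorem torsion_apply_left (hI : ∀ α, I (I α) = -α) (α β : OmniDL E L) :
    torsion I (I α) β = -I (torsion I α β) := by
  simp only [torsion, hI, map_sub, map_neg, dorfman_neg_left]
  abel

theorem torsion_apply_right (hI : ∀ α, I (I α) = -α) (α β : OmniDL E L) :
    torsion I α (I β) = -I (torsion I α β) := by
  simp only [torsion, hI, map_sub, map_neg, dorfman_neg_right]
  abel

/-- The differential of an Atiyah `2`-form, contracted with two derivations. -/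
noncomputable def dTwoContract (w : AtiyahTwoForm E L) (D D' : DL E L) : J1 E L :=
  lieDeriv D (w.flat D') - (dOne (w.flat D)).flat D' - w.flat (D.bracket D')

theorem dTwoContract_apply (w : AtiyahTwoForm E L) (D₁ D₂ D₃ : DL E L) :
    dTwoContract w D₁ D₂ D₃ = dTwo w D₁ D₂ D₃ := by
  simp only [dTwoContract, dTwo, LinearMap.sub_apply, lieDeriv_apply, dOne_apply]
  rw [w.skew D₂ (D₁.bracket D₃), w.skew D₁ (D₂.bracket D₃)]
  abel

/-- The identity derivation. -/
noncomputable def DL.one : DL E L :=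
  ⟨(LinearMap.id, 0), fun f s => by simp [VecField.zero_act]⟩

theorem DL.one_app (s : Sec E L) : (DL.one : DL E L).app s = s := rfl

theorem DL.symbol_one : (DL.one : DL E L).symbol = 0 := rfl

theorem DL.one_bracket (D : DL E L) : DL.one.bracket D = 0 := by
  refine DL.ext' (fun s => sub_self _) ?_
  rw [DL.symbol_bracket, DL.symbol_one, VecField.bracket_swap]
  have h : D.symbol.bracket 0 = 0 :=
    map_zero (AddMonoidHom.mk' D.symbol.bracket (VecField.bracket_add D.symbol))
  rw [h, neg_zero]
  rfl

/-- A closed Atiyah `2`-form is the differential of its contraction with the identity. -/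
theorem AtiyahTwoForm.eq_dOne {w : AtiyahTwoForm E L} (h : ∀ D₁ D₂ D₃, dTwo w D₁ D₂ D₃ = 0) :
    w = dOne (w.flat DL.one) := by
  refine AtiyahTwoForm.ext (LinearMap.ext fun D => LinearMap.ext fun D' => ?_)
  -- The identity acts trivially and is central, so with `η = w(𝟙, -)` closedness reads `w(D, D') -
  -- D(η D') + D'(η D) + η[D, D'] = 0`.
  have e := h DL.one D D'
  simp only [dTwo, DL.one_app, DL.one_bracket, map_zero, LinearMap.zero_apply, sub_zero,
    add_zero, w.skew (D.bracket D') DL.one] at e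
  rw [dOne_apply]
  refine sub_eq_zero.1 (Eq.trans ?_ e)
  abel

theorem dOne_one (η : J1 E L) (D : DL E L) :
    (dOne η).flat DL.one D = η D - D.app (η DL.one) := by
  rw [dOne_apply, DL.one_app, DL.one_bracket, map_zero, sub_zero]

/-- Second-order terms cancel because the bracket is the commutator; what is left is `η` of the
Jacobi identity. -/
theorem dTwo_dOne (η : J1 E L) (D₁ D₂ D₃ : DL E L) : dTwo (dOne η) D₁ D₂ D₃ = 0 := by
  have jac : (D₁.bracket D₂).bracket D₃ - (D₁.bracket D₃).bracket D₂
      + (D₂.bracket D₃).bracket D₁ = 0 := by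
    refine DL.ext' (fun s => ?_) ?_
    · change ((D₁.bracket D₂).bracket D₃).app s - ((D₁.bracket D₃).bracket D₂).app s
        + ((D₂.bracket D₃).bracket D₁).app s = 0
      simp only [DL.bracket_app, map_sub]
      abel
    · change (D₁.symbol.bracket D₂.symbol).bracket D₃.symbol
        - (D₁.symbol.bracket D₃.symbol).bracket D₂.symbol
        + (D₂.symbol.bracket D₃.symbol).bracket D₁.symbol = 0
      rw [VecField.bracket_swap (D₂.symbol.bracket D₃.symbol), VecField.leibniz,
        VecField.bracket_swap D₂.symbol]
      abel
  have jac' := congrArg η jac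
  simp only [map_add, map_sub, map_zero] at jac'
  simp only [dTwo, dOne_apply, map_sub, DL.bracket_app]
  rw [← sub_eq_zero.2 jac', ← sub_eq_zero]
  abel

theorem AtiyahTwoForm.flat_comp_apply {w : AtiyahTwoForm E L}
    {Φ : DL E L →ₗ[SmoothFun E M] DL E L} (h : w.flat ∘ₗ Φ = dagger Φ ∘ₗ w.flat) (D : DL E L) :
    w.flat (Φ D) = dagger Φ (w.flat D) :=
  LinearMap.congr_fun h D

/-! ### Integrability in terms of `ω_J` and `φ` -/

section Block

variable {Φ : DL E L →ₗ[SmoothFun E M] DL E L} {J : J1 E L →ₗ[SmoothFun E M] DL E L}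
  {w : AtiyahTwoForm E L}

/-- The graph of `-w_Φ` is the image of `J¹L` under `I`, so `I` takes it back to `J¹L`, up to sign.
-/
theorem endo_graph (hI : ∀ α, I (I α) = -α)
    (hJ : ∀ ψ, I (0, ψ) = (J ψ, -dagger Φ ψ)) (hw : ∀ D, J (w.flat D) = D)
    (h : w.flat ∘ₗ Φ = dagger Φ ∘ₗ w.flat) (D : DL E L) :
    I (D, -w.flat (Φ D)) = (0, -w.flat D) := by
  have e : (D, -w.flat (Φ D)) = I (0, w.flat D) := by
    rw [hJ, hw, w.flat_comp_apply h]
  rw [e, hI]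
  exact Prod.ext neg_zero rfl

/-- Brackets inside `J¹L` vanish. The graph fails to be closed under the bracket by `d(w_Φ)`, and
the mixed brackets differ from `-w♭[D, D']` by `dw`. -/
theorem torsion_graph (hI : ∀ α, I (I α) = -α)
    (hJ : ∀ ψ, I (0, ψ) = (J ψ, -dagger Φ ψ)) (hw : ∀ D, J (w.flat D) = D)
    (h : w.flat ∘ₗ Φ = dagger Φ ∘ₗ w.flat) (D D' : DL E L) :
    torsion I (D, -w.flat (Φ D)) (D', -w.flat (Φ D'))
      = (0, dTwoContract (w.twist Φ h) D D') + I (0, dTwoContract w D D') := by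
  have hg := endo_graph hI hJ hw h
  have e0 : dorfman (0, -w.flat D) (0, -w.flat D') = 0 := by
    refine Prod.ext (DL.bracket_zero _) (LinearMap.ext fun D'' => ?_)
    simp only [dorfman, lieDeriv_apply, DL.zero_app, DL.zero_bracket,
      map_zero, sub_zero, Prod.snd_zero, LinearMap.zero_apply]
  have e1 : dorfman (D, -w.flat (Φ D)) (D', -w.flat (Φ D'))
      = (D.bracket D', -w.flat (Φ (D.bracket D'))) - (0, dTwoContract (w.twist Φ h) D D') := by
    refine Prod.ext (sub_zero _).symm (LinearMap.ext fun D'' => ?_)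
    simp only [dorfman, dTwoContract, Prod.snd_sub, LinearMap.sub_apply, LinearMap.neg_apply,
      lieDeriv_apply, dOne_apply, AtiyahTwoForm.twist, LinearMap.comp_apply, map_neg]
    abel
  have e2 : dorfman (0, -w.flat D) (D', -w.flat (Φ D'))
      + dorfman (D, -w.flat (Φ D)) (0, -w.flat D')
      = (0, -w.flat (D.bracket D')) - (0, dTwoContract w D D') := by
    refine Prod.ext ?_ (LinearMap.ext fun D'' => ?_)
    · simp only [dorfman, Prod.fst_add, Prod.fst_sub, DL.zero_bracket, DL.bracket_zero, add_zero,
        sub_zero]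
    · simp only [dorfman, dTwoContract, Prod.snd_sub, Prod.snd_add, LinearMap.sub_apply,
        LinearMap.neg_apply, LinearMap.add_apply, lieDeriv_apply, dOne_apply, map_neg,
        DL.zero_bracket, DL.zero_app, map_zero, LinearMap.zero_apply]
      abel
  -- The graph element over `[D, D']` occurs twice, once through `I² = -id`, and cancels.
  rw [torsion, hg, hg, e0, e1, sub_sub _ (I _) (I _), ← map_add, e2, map_sub, ← hg, hI]
  abel

/-- Integrability of `ℐ` with `J` nondegenerate amounts to closedness of `ω_J` and `(ω_J)_φ`. -/
theorem torsion_eq_zero_iff (hI : ∀ α, I (I α) = -α)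
    (hJ : ∀ ψ, I (0, ψ) = (J ψ, -dagger Φ ψ)) (hw : ∀ D, J (w.flat D) = D)
    (hw' : ∀ ψ, w.flat (J ψ) = ψ) (h : w.flat ∘ₗ Φ = dagger Φ ∘ₗ w.flat) :
    (∀ α β, torsion I α β = 0) ↔
      (∀ D₁ D₂ D₃, dTwo w D₁ D₂ D₃ = 0) ∧ ∀ D₁ D₂ D₃, dTwo (w.twist Φ h) D₁ D₂ D₃ = 0 := by
  have key := torsion_graph hI hJ hw h
  constructor
  · intro H
    have h1 : ∀ D D', dTwoContract w D D' = 0 := fun D D' => by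
      have e := key D D'
      rw [H, hJ] at e
      -- Only the `dw` term has a `DL`-component, and `J` is injective.
      have e1 : 0 = 0 + J (dTwoContract w D D') := congrArg Prod.fst e
      rw [← hw' (dTwoContract w D D'), ← zero_add (J _), ← e1, map_zero]
    have h2 : ∀ D D', dTwoContract (w.twist Φ h) D D' = 0 := fun D D' => by
      have e := key D D'
      rw [H, h1, show ((0, 0) : OmniDL E L) = 0 from rfl, map_zero, add_zero] at e
      exact (congrArg Prod.snd e).symm
    refine ⟨fun D₁ D₂ D₃ => ?_, fun D₁ D₂ D₃ => ?_⟩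
    · rw [← dTwoContract_apply, h1, LinearMap.zero_apply]
    · rw [← dTwoContract_apply, h2, LinearMap.zero_apply]
  · rintro ⟨h1, h2⟩
    have h0 : ∀ D D', torsion I (D, -w.flat (Φ D)) (D', -w.flat (Φ D')) = 0 := fun D D' => by
      rw [key, show dTwoContract w D D' = 0 from LinearMap.ext fun D'' => by
          rw [dTwoContract_apply, h1, LinearMap.zero_apply],
        show dTwoContract (w.twist Φ h) D D' = 0 from LinearMap.ext fun D'' => by
          rw [dTwoContract_apply, h2, LinearMap.zero_apply],
        show ((0, 0) : OmniDL E L) = 0 from rfl, map_zero, add_zero]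
    -- The graph and its image `J¹L` span: `D` fixes the graph part and `-w♭ D'` must supply the
    -- remaining `ψ + w♭(Φ D)`.
    have hdec : ∀ α : OmniDL E L, ∃ D D', α = (D, -w.flat (Φ D)) + I (D', -w.flat (Φ D')) := by
      rintro ⟨D, ψ⟩
      refine ⟨D, -J (ψ + w.flat (Φ D)), ?_⟩
      rw [endo_graph hI hJ hw h, map_neg, hw', neg_neg]
      exact Prod.ext (add_zero D).symm (by simp)
    intro α β
    obtain ⟨D, D', rfl⟩ := hdec α
    obtain ⟨A, A', rfl⟩ := hdec β
    simp only [torsion_add_left, torsion_add_right, torsion_apply_left hI,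
      torsion_apply_right hI, h0, map_zero, neg_zero, add_zero]

end Block

end OmniAlgebra

/-! ### Leibniz rules for vector fields acting on functions -/

section Derivative

variable {E : Type*} [NormedAddCommGroup E] [NormedSpace ℝ E]
  {M : Type*} [TopologicalSpace M] [ChartedSpace E M] [IsManifold 𝓘(ℝ, E) ∞ M]

theorem VecField.act_add (X : VecField E M) (f g : SmoothFun E M) :
    X.act (f + g) = X.act f + X.act g := by
  ext x
  have h := mvfderiv_add (I := 𝓘(ℝ, E)) (f.mdifferentiableAt (x := x)) (g.mdifferentiableAt (x := x))
  exact congrArg (fun l => l (X x)) h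

theorem VecField.act_mul (X : VecField E M) (f g : SmoothFun E M) :
    X.act (f * g) = X.act f * g + f * X.act g := by
  ext x
  have h := mvfderiv_mul (I := 𝓘(ℝ, E)) (f.mdifferentiableAt (x := x)) (g.mdifferentiableAt (x := x))
  refine (congrArg (fun l => l (X x)) h).trans ?_
  change f x * X.act g x + g x * X.act f x = X.act f x * g x + f x * X.act g x
  ring

theorem VecField.act_smul (X : VecField E M) (r : ℝ) (f : SmoothFun E M) :
    X.act (r • f) = r • X.act f := by
  have h1 : r • f = ContMDiffMap.const r * f := rfl
  have h2 : X.act (ContMDiffMap.const r) = 0 := by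
    ext x
    exact congrArg (fun l => l (X x)) (mvfderiv_const (I := 𝓘(ℝ, E)) r (x := x))
  rw [h1, VecField.act_mul, h2, zero_mul, zero_add]
  rfl

end Derivative

/-! ### Local generators of `L`, symbols, and forms that descend to `TM` -/

section LineFrames

variable {E : Type*} [NormedAddCommGroup E] [NormedSpace ℝ E] [FiniteDimensional ℝ E]
  {M : Type*} [TopologicalSpace M] [T2Space M] [ChartedSpace E M] [IsManifold 𝓘(ℝ, E) ∞ M]

/-- A map of sections which is linear over functions is determined pointwise. -/
theorem map_section_eq_zero {F F' : Type*} [NormedAddCommGroup F] [NormedSpace ℝ F]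
    [FiniteDimensional ℝ F] [NormedAddCommGroup F'] [NormedSpace ℝ F']
    {V V' : M → Type*} [TopologicalSpace (TotalSpace F V)]
    [∀ x, AddCommGroup (V x)] [∀ x, Module ℝ (V x)] [∀ x, TopologicalSpace (V x)]
    [FiberBundle F V] [VectorBundle ℝ F V] [ContMDiffVectorBundle ∞ F V 𝓘(ℝ, E)]
    [TopologicalSpace (TotalSpace F' V')]
    [∀ x, AddCommGroup (V' x)] [∀ x, Module ℝ (V' x)] [∀ x, TopologicalSpace (V' x)]
    [FiberBundle F' V'] [VectorBundle ℝ F' V']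
    (G : Cₛ^∞⟮𝓘(ℝ, E); F, V⟯ →ₗ[SmoothFun E M] Cₛ^∞⟮𝓘(ℝ, E); F', V'⟯)
    {s : Cₛ^∞⟮𝓘(ℝ, E); F, V⟯} {x : M} (hs : s x = 0) : G s x = 0 := by
  obtain ⟨ρ, c, t, hρ, hc, -, h0⟩ := exists_smooth_frame (E := E) V (Module.finBasis ℝ F) x
  have h := congrArg (fun s => G s x) (hc s)
  simp only [map_sum, map_smul, sum_section_apply, fun_smul_apply, hρ.self_of_nhds, one_smul] at h
  rw [← h]
  exact Finset.sum_eq_zero fun i _ => by rw [h0 i s hs, zero_smul]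

instance : ContMDiffVectorBundle ∞ E (TangentSpace 𝓘(ℝ, E) : M → Type _) 𝓘(ℝ, E) := by
  have : IsManifold 𝓘(ℝ, E) (∞ + 1) M := by simpa
  exact TangentBundle.contMDiffVectorBundle

variable {L : M → Type*} [TopologicalSpace (TotalSpace ℝ L)]
  [∀ x, AddCommGroup (L x)] [∀ x, Module ℝ (L x)] [∀ x, TopologicalSpace (L x)]
  [FiberBundle ℝ L] [VectorBundle ℝ ℝ L]

variable (E L) in
/-- A cut-off generator of a line bundle around `x`. -/
structure LineFrame (x : M) where
  cutoff : SmoothFun E M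
  coeff : Sec E L →ₗ[SmoothFun E M] SmoothFun E M
  gen : Sec E L
  cutoff_eq : ∀ᶠ y in nhds x, cutoff y = 1
  coeff_smul : ∀ s, coeff s • gen = cutoff • s
  coeff_gen : coeff gen x = 1
  coeff_eq_zero : ∀ s, s x = 0 → coeff s x = 0

variable (E L) in
theorem nonempty_lineFrame [ContMDiffVectorBundle ∞ ℝ L 𝓘(ℝ, E)] (x : M) :
    Nonempty (LineFrame E L x) := by
  obtain ⟨ρ, c, t, hρ, hc, h1, h0⟩ :=
    exists_smooth_frame (E := E) L (Module.Basis.singleton Unit ℝ) x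
  exact ⟨ρ, c (), t (), hρ, fun s => by simpa using hc s, by simpa using h1 () (), h0 ()⟩

namespace LineFrame

variable {x : M} (T : LineFrame E L x)

theorem cutoff_self : T.cutoff x = 1 := T.cutoff_eq.self_of_nhds

theorem apply_eq (s : Sec E L) : s x = T.coeff s x • T.gen x := by
  have h := congrArg (fun s : Sec E L => s x) (T.coeff_smul s)
  simp only [fun_smul_apply, T.cutoff_self, one_smul] at h
  exact h.symm

theorem gen_ne_zero : T.gen x ≠ 0 := fun h => by
  simpa [T.coeff_gen] using T.coeff_eq_zero _ h

theorem exists_eq_smul [ContMDiffVectorBundle ∞ ℝ L 𝓘(ℝ, E)] (l : L x) :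
    ∃ r : ℝ, l = r • T.gen x := by
  obtain ⟨s, rfl⟩ := exists_section_eq (E := E) (F := ℝ) L x l
  exact ⟨_, T.apply_eq s⟩

theorem exists_eq_smul_of_ne_zero (T : LineFrame E L x)
    [ContMDiffVectorBundle ∞ ℝ L 𝓘(ℝ, E)] {k : L x} (hk : k ≠ 0)
    (l : L x) : ∃ r : ℝ, l = r • k := by
  obtain ⟨r, rfl⟩ := T.exists_eq_smul l
  obtain ⟨q, rfl⟩ := T.exists_eq_smul k
  have hq : q ≠ 0 := fun h => hk (by rw [h, zero_smul])
  exact ⟨r / q, by rw [smul_smul, div_mul_cancel₀ _ hq]⟩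

theorem coeff_ne_zero {s : Sec E L} (hs : s x ≠ 0) : T.coeff s x ≠ 0 := fun h =>
  hs (by rw [T.apply_eq s, h, zero_smul])

/-- The flat connection of a line frame, cut off to be globally defined. -/
noncomputable def conn : VecField E M →ₗ[SmoothFun E M] DL E L where
  toFun X := ⟨({ toFun := fun s => X.act (T.coeff s) • T.gen
                 map_add' := fun s s' => by rw [map_add, VecField.act_add, add_smul]
                 map_smul' := fun r s => by
                  rw [LinearMap.map_smul_of_tower, VecField.act_smul, RingHom.id_apply,
                    smul_assoc] }, T.cutoff • X), fun f s => by
      -- Since `c(s) t = χ s`, the Leibniz rule gives `X(f) c(s) t = χ X(f) s`; hence the symbol is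
      -- `χ X`.
      change X.act (T.coeff (f • s)) • T.gen
        = (T.cutoff • X).act f • s + f • X.act (T.coeff s) • T.gen
      rw [map_smul, smul_eq_mul, VecField.act_mul, add_smul, mul_smul, T.coeff_smul,
        VecField.smul_act, mul_smul f, smul_smul, mul_comm T.cutoff]⟩
  map_add' X Y := DL.ext' (fun s => by
      change (X + Y).act (T.coeff s) • T.gen
        = X.act (T.coeff s) • T.gen + Y.act (T.coeff s) • T.gen
      rw [VecField.add_act, add_smul]) (smul_add _ _ _)
  map_smul' f X := DL.ext' (fun s => by
      change (f • X).act (T.coeff s) • T.gen = f • X.act (T.coeff s) • T.gen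
      rw [VecField.smul_act, mul_smul]) (smul_comm _ _ _)

theorem symbol_conn (X : VecField E M) : (T.conn X).symbol = T.cutoff • X := rfl

theorem symbol_conn_apply (X : VecField E M) : (T.conn X).symbol x = X x := by
  rw [symbol_conn, fun_smul_apply, T.cutoff_self, one_smul]

end LineFrame

theorem DL.app_eq_smul_of_symbol_eq_zero {D : DL E L} (h : D.symbol = 0) (f : SmoothFun E M)
    (s : Sec E L) : D.app (f • s) = f • D.app s := by
  rw [DL.app_smul, h, VecField.zero_act, zero_smul, zero_add]

/-- Derivations with trivial symbol are locally multiples of the identity. -/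
theorem LineFrame.cutoff_smul_of_symbol_eq_zero {x : M} (T : LineFrame E L x) {D : DL E L}
    (h : D.symbol = 0) :
    (T.cutoff * T.cutoff) • D = (T.coeff (D.app T.gen) * T.cutoff) • (DL.one : DL E L) := by
  refine DL.ext' (fun s => ?_) ?_
  -- With zero symbol `D` is `C^∞`-linear, so it is determined by its value on the generator.
  · have e : T.cutoff • D.app s = T.coeff s • D.app T.gen := by
      rw [← DL.app_eq_smul_of_symbol_eq_zero h, ← T.coeff_smul,
        DL.app_eq_smul_of_symbol_eq_zero h]
    rw [DL.smul_app, DL.smul_app, DL.one_app, mul_smul, mul_smul, e, smul_comm, ← T.coeff_smul,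
      ← T.coeff_smul s, smul_comm]
  · rw [DL.symbol_smul, DL.symbol_smul, h, DL.symbol_one, smul_zero, smul_zero]

/-- If the symbol of `D` vanishes at `x`, then `D` is a multiple of the identity at `x`. -/
theorem DL.exists_eq_smul_one [ContMDiffVectorBundle ∞ ℝ L 𝓘(ℝ, E)] {D : DL E L} {x : M}
    (h : D.symbol x = 0) : ∃ r : ℝ, ∀ ψ : J1 E L, ψ D x = r • ψ DL.one x := by
  obtain ⟨T⟩ := nonempty_lineFrame E L x
  have hR : (T.cutoff • D - T.conn D.symbol).symbol = 0 := sub_self (T.cutoff • D.symbol)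
  refine ⟨T.coeff ((T.cutoff • D - T.conn D.symbol).app T.gen) x, fun ψ => ?_⟩
  have e := congrArg (fun D => ψ D x) (T.cutoff_smul_of_symbol_eq_zero hR)
  -- Near `x`, `D` is its horizontal part plus a multiple of the identity; the horizontal part is
  -- tensorial in `σD`, which vanishes at `x`.
  have h0 : ψ (T.conn D.symbol) x = 0 := map_section_eq_zero (ψ ∘ₗ T.conn) h
  simp only [map_smul, map_sub, fun_smul_apply, ContMDiffMap.coe_mul, Pi.mul_apply,
    T.cutoff_self, mul_one, one_smul, ContMDiffSection.coe_sub, Pi.sub_apply, h0, sub_zero] at e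
  exact e

/-- The jet prolongation of a section. -/
noncomputable def jet (s : Sec E L) : J1 E L where
  toFun D := D.app s
  map_add' _ _ := rfl
  map_smul' _ _ := rfl

theorem jet_apply (s : Sec E L) (D : DL E L) : jet s D = D.app s := rfl

/-- The symbol at a point is detected by Atiyah `1`-forms. -/
theorem DL.symbol_eq_zero [ContMDiffVectorBundle ∞ ℝ L 𝓘(ℝ, E)] {D : DL E L} {x : M}
    (h : ∀ ψ : J1 E L, ψ D x = 0) : D.symbol x = 0 := by
  obtain ⟨T⟩ := nonempty_lineFrame E L x
  obtain ⟨ρ, a, X, hρ, ha, -, -⟩ := exists_smooth_frame (E := E)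
    (TangentSpace 𝓘(ℝ, E) : M → Type _) (Module.finBasis ℝ E) x
  have hx : ∀ i, a i D.symbol x = 0 := fun i => by
    let ψ : J1 E L :=
      { toFun := fun D => a i D.symbol • T.gen
        map_add' := fun D D' => by rw [DL.symbol_add, map_add, add_smul]
        map_smul' := fun f D => by
          rw [DL.symbol_smul, map_smul, smul_eq_mul, mul_smul, RingHom.id_apply] }
    exact (smul_eq_zero.1 (h ψ)).resolve_right T.gen_ne_zero
  have e := congrArg (fun Y : VecField E M => Y x) (ha D.symbol)
  simp only [sum_section_apply, fun_smul_apply, hρ.self_of_nhds, one_smul, hx, zero_smul,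
    Finset.sum_const_zero] at e
  exact e.symm

/-- Every tangent vector is the symbol of a derivation. -/
theorem DL.exists_symbol_eq [ContMDiffVectorBundle ∞ ℝ L 𝓘(ℝ, E)] (x : M)
    (v : TangentSpace 𝓘(ℝ, E) x) : ∃ D : DL E L, D.symbol x = v := by
  obtain ⟨T⟩ := nonempty_lineFrame E L x
  obtain ⟨X, hX⟩ := exists_section_eq (E := E) (F := E)
    (TangentSpace 𝓘(ℝ, E) : M → Type _) x v
  exact ⟨T.conn X, (T.symbol_conn_apply X).trans hX⟩

/-- An Atiyah `1`-form killing the identity is the pullback of a form on `TM`. -/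
theorem exists_form_of_apply_one_eq_zero [ContMDiffVectorBundle ∞ ℝ L 𝓘(ℝ, E)] {η : J1 E L}
    (hη : η DL.one = 0) (x : M) :
    ∃ θ : TangentSpace 𝓘(ℝ, E) x →ₗ[ℝ] L x, ∀ D : DL E L, θ (D.symbol x) = η D x := by
  let S : DL E L →ₗ[ℝ] TangentSpace 𝓘(ℝ, E) x :=
    { toFun := fun D => D.symbol x
      map_add' := fun _ _ => rfl
      map_smul' := fun _ _ => rfl }
  -- Any linear choice of lifts works: two lifts of a tangent vector differ at `x` by a multiple of
  -- the identity, which `η` kills.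
  obtain ⟨r, hr⟩ := S.exists_rightInverse_of_surjective
    (LinearMap.range_eq_top.2 (DL.exists_symbol_eq x))
  refine ⟨secEval L x ∘ₗ η.restrictScalars ℝ ∘ₗ r, fun D => ?_⟩
  have h0 : (r (D.symbol x) - D).symbol x = 0 := by
    have := LinearMap.congr_fun hr (D.symbol x)
    exact sub_eq_zero.2 this
  obtain ⟨q, hq⟩ := DL.exists_eq_smul_one h0
  have e := hq η
  rw [hη, map_sub] at e
  have e' : η (r (D.symbol x)) x - η D x = q • (0 : L x) := e
  rw [smul_zero] at e'
  exact sub_eq_zero.1 e'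

end LineFrames

/-! ### Nondegeneracy versus maximal non-integrability -/

section Contact

variable {E : Type*} [NormedAddCommGroup E] [NormedSpace ℝ E] [FiniteDimensional ℝ E]
  {M : Type*} [TopologicalSpace M] [T2Space M] [ChartedSpace E M] [IsManifold 𝓘(ℝ, E) ∞ M]
  {L : M → Type*} [TopologicalSpace (TotalSpace ℝ L)]
  [∀ x, AddCommGroup (L x)] [∀ x, Module ℝ (L x)] [∀ x, TopologicalSpace (L x)]
  [FiberBundle ℝ L] [VectorBundle ℝ ℝ L] [ContMDiffVectorBundle ∞ ℝ L 𝓘(ℝ, E)]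

/-- Any derivation can be corrected by a multiple of `D₀` to lie in the kernel of `η`. -/
theorem exists_smul_sub_mem_ker (η : J1 E L) {D₀ : DL E L} {x : M} (h₀ : η D₀ x ≠ 0)
    (D : DL E L) : ∃ m k : SmoothFun E M, m x ≠ 0 ∧ (η D x = 0 → k x = 0) ∧
      η (m • D - k • D₀) = 0 := by
  obtain ⟨T⟩ := nonempty_lineFrame E L x
  -- As `L` has rank one, cross-multiplying by coefficients replaces division by `η D₀`.
  refine ⟨T.cutoff * T.coeff (η D₀), T.cutoff * T.coeff (η D), ?_, fun h => ?_, ?_⟩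
  · rw [ContMDiffMap.coe_mul, Pi.mul_apply, T.cutoff_self, one_mul]
    exact T.coeff_ne_zero h₀
  · rw [ContMDiffMap.coe_mul, Pi.mul_apply, T.coeff_eq_zero _ h, mul_zero]
  · rw [map_sub, map_smul, map_smul, mul_comm, mul_comm T.cutoff, mul_smul, mul_smul,
      ← T.coeff_smul, ← T.coeff_smul, smul_comm, sub_self]

/-- Both derivative terms vanish on `ker η`; what remains is minus the curvature form of the contact
condition. -/
theorem dOne_eq_neg_bracket {η : J1 E L} {D D' : DL E L} (h : η D = 0) (h' : η D' = 0) :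
    (dOne η).flat D D' = -η (D.bracket D') := by
  rw [dOne_apply, h, h', map_zero, map_zero, sub_self, zero_sub]

theorem dOne_flat_one {η : J1 E L} (hη : η DL.one = 0) (D : DL E L) :
    (dOne η).flat DL.one D = η D := by
  rw [dOne_one, hη, map_zero, sub_zero]

/-- The derivative of the cutoff contributes only a multiple of `X x`, which `θ` kills when `X` lies
in `H`. -/
theorem LineFrame.symbol_bracket_conn {x : M} (T : LineFrame E L x) (D : DL E L)
    (X : VecField E M) :
    (D.bracket (T.conn X)).symbol x
      = D.symbol.act T.cutoff x • X x + D.symbol.bracket X x := by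
  rw [DL.symbol_bracket, T.symbol_conn, VecField.bracket_smul, ContMDiffSection.coe_add,
    Pi.add_apply, fun_smul_apply, fun_smul_apply, T.cutoff_self, one_smul]

/-- A nondegenerate exact Atiyah `2`-form comes from a contact structure. -/
theorem exists_contactStructure {η : J1 E L} (hη : η DL.one = 0)
    (hs : Function.Surjective (dOne η).flat) :
    ∃ C : ContactStructure E L, C.pullbackθ = η := by
  choose θ hθ using exists_form_of_apply_one_eq_zero (E := E) hη
  -- If `dη(A, -)` is the jet of a generator, evaluating at the identity gives `-η A` equal to that
  -- generator.
  have hA : ∀ x, ∃ A : DL E L, η A x ≠ 0 := fun x => by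
    obtain ⟨T⟩ := nonempty_lineFrame E L x
    obtain ⟨A, hA⟩ := hs (jet T.gen)
    refine ⟨A, fun h => T.gen_ne_zero ?_⟩
    have e := LinearMap.congr_fun hA DL.one
    rw [(dOne η).skew, dOne_flat_one hη, jet_apply, DL.one_app] at e
    rw [← e]
    exact neg_eq_zero.2 h
  refine ⟨⟨fun x => LinearMap.ker (θ x), θ, fun X x => ?_, fun _ => rfl, fun x l => ?_,
    fun X hX x hXx => ?_⟩, ?_⟩
  · obtain ⟨T⟩ := nonempty_lineFrame E L x
    refine ((η (T.conn X)).contMDiff x).congr_of_eventuallyEq ?_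
    filter_upwards [T.cutoff_eq] with y hy
    rw [← hθ y, T.symbol_conn, fun_smul_apply, hy, one_smul]
  · obtain ⟨T⟩ := nonempty_lineFrame E L x
    obtain ⟨A, hA⟩ := hA x
    obtain ⟨r, hr⟩ := T.exists_eq_smul_of_ne_zero hA l
    exact ⟨r • A.symbol x, by rw [map_smul, hθ, hr]⟩
  · obtain ⟨T⟩ := nonempty_lineFrame E L x
    obtain ⟨D₀, h₀⟩ := hA x
    let D : DL E L := T.conn X
    have hD : η D = 0 := by
      ext y
      rw [← hθ y, T.symbol_conn, fun_smul_apply, map_smul, show θ y (X y) = 0 from hX y,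
        smul_zero]
      rfl
    -- Adding `r` times the identity adds `r η` to `dη(D, -)`; this `r` kills the value on `D₀`, and
    -- `ker η` is unaffected.
    obtain ⟨r, hr⟩ := T.exists_eq_smul_of_ne_zero h₀ (-((dOne η).flat D D₀ x))
    let D₁ : DL E L := D + (ContMDiffMap.const r : SmoothFun E M) • DL.one
    have hval : ∀ D' : DL E L, (dOne η).flat D₁ D' x = (dOne η).flat D D' x + r • η D' x := by
      intro D'
      simp only [D₁, map_add, map_smul, LinearMap.add_apply, LinearMap.smul_apply,
        dOne_flat_one hη]
      rfl
    have hker : ∀ D', η D' = 0 → (dOne η).flat D D' x = 0 := by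
      intro D' hD'
      rw [(dOne η).skew, dOne_eq_neg_bracket hD' hD, neg_neg, ← hθ, T.symbol_bracket_conn,
        map_add, map_smul, show θ x (X x) = 0 from hX x, smul_zero, zero_add,
        VecField.bracket_swap, ContMDiffSection.coe_neg, Pi.neg_apply, map_neg,
        hXx D'.symbol fun y => by
          rw [LinearMap.mem_ker, hθ, hD']; rfl, neg_zero]
    have hzero : ∀ D', (dOne η).flat D₁ D' x = 0 := by
      intro D'
      obtain ⟨m, k, hm, -, hmk⟩ := exists_smul_sub_mem_ker η h₀ D'
      have e := hval (m • D' - k • D₀)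
      rw [hker _ hmk, hmk, map_sub, map_smul, map_smul] at e
      have e' : m x • (dOne η).flat D₁ D' x - k x • (dOne η).flat D₁ D₀ x
        = 0 + r • (0 : L x) := e
      rw [hval D₀, ← hr, add_neg_cancel, smul_zero, smul_zero, sub_zero, add_zero] at e'
      exact (smul_eq_zero.1 e').resolve_left hm
    -- `D₁` is in the kernel of `dη` at `x`, and every Atiyah `1`-form is some `dη(A, -)`.
    have hsym : D₁.symbol x = 0 := DL.symbol_eq_zero fun ψ => by
      obtain ⟨A, rfl⟩ := hs ψ
      rw [(dOne η).skew, ContMDiffSection.coe_neg, Pi.neg_apply, hzero, neg_zero]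
    have e : D₁.symbol x = (T.conn X).symbol x + r • (0 : TangentSpace 𝓘(ℝ, E) x) := rfl
    rw [← T.symbol_conn_apply X, ← hsym, e, smul_zero, add_zero]
  · refine LinearMap.ext fun D => ?_
    ext x
    exact hθ x D

namespace ContactStructure

variable (C : ContactStructure E L)

theorem pullbackθ_apply (D : DL E L) (x : M) : C.pullbackθ D x = C.θ x (D.symbol x) := rfl

theorem pullbackθ_one : (C.pullbackθ : J1 E L) DL.one = 0 := by
  ext x
  exact map_zero (C.θ x)

theorem form_flat_one : C.form.flat DL.one = C.pullbackθ :=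
  LinearMap.ext (dOne_flat_one C.pullbackθ_one)

/-- The Atiyah `2`-form determines the contact structure. -/
theorem form_injective : Function.Injective (form : ContactStructure E L → AtiyahTwoForm E L) := by
  intro C C' h
  have hp : C.pullbackθ = C'.pullbackθ := by rw [← form_flat_one, h, form_flat_one]
  have hθ : C.θ = C'.θ := by
    funext x
    refine LinearMap.ext fun v => ?_
    obtain ⟨D, rfl⟩ := DL.exists_symbol_eq (L := L) x v
    exact congrArg (fun η : J1 E L => η D x) hp
  refine ContactStructure.ext (funext fun x => ?_) hθ
  rw [← C.ker_eq, ← C'.ker_eq, hθ]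

theorem exists_pullbackθ_ne_zero (x : M) : ∃ D : DL E L, C.pullbackθ D x ≠ 0 := by
  obtain ⟨T⟩ := nonempty_lineFrame E L x
  obtain ⟨v, hv⟩ := C.surjective x (T.gen x)
  obtain ⟨D, rfl⟩ := DL.exists_symbol_eq (L := L) x v
  exact ⟨D, fun h => T.gen_ne_zero (hv.symm.trans h)⟩

/-- The Atiyah `2`-form of a contact structure is nondegenerate at every point. -/
theorem apply_eq_zero_of_form_eq_zero {D : DL E L} {x : M} (h : ∀ D', C.form.flat D D' x = 0)
    (ψ : J1 E L) : ψ D x = 0 := by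
  obtain ⟨T⟩ := nonempty_lineFrame E L x
  obtain ⟨D₀, h₀⟩ := C.exists_pullbackθ_ne_zero x
  have hD : C.pullbackθ D x = 0 := by
    have e := h DL.one
    rw [C.form.skew, C.form_flat_one] at e
    exact neg_eq_zero.1 e
  have hsym : D.symbol x = 0 := by
    -- Non-integrability concerns global sections of `H`, so `D` is corrected everywhere; as `k x =
    -- 0`, at `x` it is only rescaled.
    obtain ⟨m, k, hm, hk, hmk⟩ := exists_smul_sub_mem_ker C.pullbackθ h₀ D
    have hX : ∀ y, (m • D - k • D₀).symbol y ∈ C.H y := fun y => by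
      rw [← C.ker_eq, LinearMap.mem_ker, ← C.pullbackθ_apply, hmk]
      rfl
    have e := C.nonintegrable _ hX x fun Y hY => ?_
    · have e' : m x • D.symbol x - k x • D₀.symbol x = 0 := e
      rw [hk hD, zero_smul, sub_zero] at e'
      exact (smul_eq_zero.1 e').resolve_left hm
    · have hYθ : ∀ y, C.θ y (Y y) = 0 := fun y => by
        rw [← LinearMap.mem_ker, C.ker_eq]
        exact hY y
      have hY0 : C.pullbackθ (T.conn Y) = 0 := by
        ext y
        rw [C.pullbackθ_apply, T.symbol_conn, fun_smul_apply, map_smul, hYθ, smul_zero]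
        rfl
      have e1 : C.form.flat (m • D - k • D₀) (T.conn Y) x = 0 := by
        rw [map_sub, map_smul, map_smul]
        change m x • C.form.flat D (T.conn Y) x - k x • C.form.flat D₀ (T.conn Y) x = 0
        rw [h, hk hD, smul_zero, zero_smul, sub_zero]
      rw [form, dOne_eq_neg_bracket hmk hY0, ContMDiffSection.coe_neg, Pi.neg_apply,
        neg_eq_zero, C.pullbackθ_apply, T.symbol_bracket_conn, map_add, map_smul, hYθ,
        smul_zero, zero_add] at e1
      exact e1
  -- At `x` now `D = r 𝟙`, and pairing with `D₀` gives `r (σ*θ)(D₀) = 0`, so `r = 0`.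
  obtain ⟨r, hr⟩ := DL.exists_eq_smul_one hsym
  have e := h D₀
  rw [C.form.skew, ContMDiffSection.coe_neg, Pi.neg_apply, neg_eq_zero, hr, C.form.skew,
    C.form_flat_one, ContMDiffSection.coe_neg, Pi.neg_apply, smul_neg, neg_eq_zero] at e
  rw [hr, (smul_eq_zero.1 e).resolve_right h₀, zero_smul]

end ContactStructure

end Contact

/-! ### Gluing sections up to multipliers -/

section Gluing

variable {E : Type*} [NormedAddCommGroup E] [NormedSpace ℝ E]
  {M : Type*} [TopologicalSpace M] [ChartedSpace E M]
  {F : Type*} [NormedAddCommGroup F] [NormedSpace ℝ F]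
  {V : M → Type*} [TopologicalSpace (TotalSpace F V)]
  [∀ x, AddCommGroup (V x)] [∀ x, Module ℝ (V x)] [∀ x, TopologicalSpace (V x)]
  [FiberBundle F V] [VectorBundle ℝ F V]
  {h : M → SmoothFun E M}

theorem section_ext_of_smul (hh : ∀ z, h z z ≠ 0) {s s' : Cₛ^∞⟮𝓘(ℝ, E); F, V⟯}
    (e : ∀ z, h z • s = h z • s') : s = s' := by
  ext z
  exact smul_right_injective _ (hh z) (congrArg (fun s : Cₛ^∞⟮𝓘(ℝ, E); F, V⟯ => s z) (e z))

/-- Gluing of sections which are compatible up to smooth multipliers. -/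
theorem exists_glued_section (hh : ∀ z, h z z ≠ 0) (s : M → Cₛ^∞⟮𝓘(ℝ, E); F, V⟯)
    (hs : ∀ y z, h y • s z = h z • s y) :
    ∃ σ : Cₛ^∞⟮𝓘(ℝ, E); F, V⟯, ∀ z, h z • σ = s z := by
  have key : ∀ y z, h z y • ((h y y)⁻¹ • s y y) = s z y := fun y z => by
    have e : h y y • s z y = h z y • s y y :=
      congrArg (fun s : Cₛ^∞⟮𝓘(ℝ, E); F, V⟯ => s y) (hs y z)
    rw [smul_comm, ← e, smul_smul, inv_mul_cancel₀ (hh y), one_smul]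
  -- At `y` only the multiplier nonzero there is inverted; near `z`, compatibility turns this into
  -- the smooth section `(h z)⁻¹ • s z`.
  refine ⟨⟨fun y => (h y y)⁻¹ • s y y, fun z => ?_⟩, fun z => ?_⟩
  · have h1 : ContMDiffAt 𝓘(ℝ, E) 𝓘(ℝ, ℝ) ∞ (fun y => (h z y)⁻¹) z :=
      ((contDiffAt_inv ℝ (hh z)).contMDiffAt).comp z ((h z).contMDiff z)
    refine (h1.smul_section ((s z).contMDiff z)).congr_of_eventuallyEq ?_
    filter_upwards [(h z).contMDiff.continuous.continuousAt.eventually_ne (hh z)] with y hy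
    congr 1
    change (h y y)⁻¹ • s y y = (h z y)⁻¹ • s z y
    rw [← key y z, smul_smul _ (h z y), inv_mul_cancel₀ hy, one_smul]
  · ext y
    exact key y z

end Gluing

/-! ### Global invertibility of the form of a contact structure -/

section Inverse

variable {E : Type*} [NormedAddCommGroup E] [NormedSpace ℝ E] [FiniteDimensional ℝ E]
  {M : Type*} [TopologicalSpace M] [ChartedSpace E M] [IsManifold 𝓘(ℝ, E) ∞ M]
  {L : M → Type*} [TopologicalSpace (TotalSpace ℝ L)]
  [∀ x, AddCommGroup (L x)] [∀ x, Module ℝ (L x)] [∀ x, TopologicalSpace (L x)]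
  [FiberBundle ℝ L] [VectorBundle ℝ ℝ L]

/-- Gluing of derivations which are compatible up to smooth multipliers. -/
theorem exists_glued_derivation {h : M → SmoothFun E M} (hh : ∀ z, h z z ≠ 0) (D : M → DL E L)
    (hD : ∀ y z, h y • D z = h z • D y) : ∃ Δ : DL E L, ∀ z, h z • Δ = D z := by
  have h1 : ∀ s, ∃ σ : Sec E L, ∀ z, h z • σ = (D z).app s := fun s =>
    exists_glued_section hh (fun z => (D z).app s) fun y z =>
      congrArg (fun D : DL E L => D.app s) (hD y z)
  obtain ⟨X, hX⟩ := exists_glued_section hh (fun z => (D z).symbol) fun y z =>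
    congrArg DL.symbol (hD y z)
  choose Δ hΔ using h1
  refine ⟨⟨({ toFun := Δ
              map_add' := fun s s' => section_ext_of_smul hh fun z => ?_
              map_smul' := fun r s => section_ext_of_smul hh fun z => ?_ }, X),
    fun f s => section_ext_of_smul hh fun z => ?_⟩, fun z => DL.ext' (hΔ · z) (hX z)⟩
  · rw [smul_add, hΔ, hΔ, hΔ, map_add]
  · rw [RingHom.id_apply, smul_comm, hΔ, hΔ, map_smul]
  · change h z • Δ (f • s) = h z • (VecField.act X f • s + f • Δ s)
    rw [hΔ, DL.app_smul, smul_add, smul_comm _ f, hΔ, smul_smul, ← VecField.smul_act, hX]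

/-- Injectivity makes the local preimages compatible: `h y • D z` and `h z • D y` both map to `h y h
z ψ`. No partition of unity is needed. -/
theorem surjective_of_locally_surjective {G : DL E L →ₗ[SmoothFun E M] J1 E L}
    (hinj : Function.Injective G)
    (hG : ∀ (ψ : J1 E L) (x : M), ∃ (D : DL E L) (f : SmoothFun E M), f x ≠ 0 ∧ G D = f • ψ) :
    Function.Surjective G := by
  intro ψ
  choose D h hh hD using hG ψ
  obtain ⟨Δ, hΔ⟩ := exists_glued_derivation hh D fun y z => hinj (by
    rw [map_smul, map_smul, hD, hD, smul_comm])
  refine ⟨Δ, LinearMap.ext fun D' => section_ext_of_smul hh fun z => ?_⟩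
  rw [← LinearMap.smul_apply, ← map_smul, hΔ, hD, LinearMap.smul_apply]

variable [T2Space M] [ContMDiffVectorBundle ∞ ℝ L 𝓘(ℝ, E)]

/-- A cut-off local frame of the Atiyah algebroid. -/
theorem exists_derivation_frame (x : M) : ∃ (n : ℕ) (κ : SmoothFun E M)
    (Fr : Option (Fin n) → DL E L), κ x = 1 ∧
    (∀ D, ∃ k : Option (Fin n) → SmoothFun E M, κ • D = ∑ j, k j • Fr j) ∧
    ∀ u : Option (Fin n) → ℝ, (∀ ψ : J1 E L, ∑ j, u j • ψ (Fr j) x = 0) → u = 0 := by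
  obtain ⟨T⟩ := nonempty_lineFrame E L x
  obtain ⟨ρ, a, X, hρ, ha, ha1, ha0⟩ := exists_smooth_frame (E := E)
    (TangentSpace 𝓘(ℝ, E) : M → Type _) (Module.finBasis ℝ E) x
  refine ⟨_, ρ * (T.cutoff * T.cutoff * T.cutoff),
    fun j => j.elim DL.one fun i => T.conn (X i), ?_, fun D => ?_, fun u hu => ?_⟩
  · simp only [ContMDiffMap.coe_mul, Pi.mul_apply, T.cutoff_self, hρ.self_of_nhds, mul_one]
  -- The horizontal part expands in the tangent frame; the rest has zero symbol, hence is locally a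
  -- multiple of the identity.
  · have hR : (T.cutoff • D - T.conn D.symbol).symbol = 0 := sub_self (T.cutoff • D.symbol)
    have e := T.cutoff_smul_of_symbol_eq_zero hR
    have e' : ρ • T.conn D.symbol = ∑ i, a i D.symbol • T.conn (X i) := by
      rw [← map_smul, ← ha, map_sum]
      simp only [map_smul]
    refine ⟨fun j => j.elim
      (ρ * (T.coeff ((T.cutoff • D - T.conn D.symbol).app T.gen) * T.cutoff))
      fun i => T.cutoff * T.cutoff * a i D.symbol, ?_⟩
    rw [Fintype.sum_option]
    simp only [Option.elim, mul_smul _ (a _ _)]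
    rw [← Finset.smul_sum, ← e', mul_smul ρ (T.coeff _ * _), ← e, smul_sub, smul_sub,
      smul_comm ρ _ (T.conn _), sub_add_cancel, smul_smul, smul_smul, mul_assoc ρ]
  · let D : DL E L := ∑ j, (ContMDiffMap.const (u j) : SmoothFun E M) •
      (j.elim DL.one fun i => T.conn (X i) : DL E L)
    have hψ : ∀ ψ : J1 E L, ψ D x = 0 := fun ψ => by
      rw [← hu ψ]
      simp only [D, map_sum, map_smul, sum_section_apply]
      rfl
    have hD : D.symbol = ∑ i, (ContMDiffMap.const (u (some i)) : SmoothFun E M) •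
        T.cutoff • X i := by
      let σ : DL E L →ₗ[SmoothFun E M] VecField E M :=
        LinearMap.snd (SmoothFun E M) _ _ ∘ₗ (derivations E L).subtype
      change σ D = _
      simp only [D, Fintype.sum_option, Option.elim]
      rw [map_add, map_sum, map_smul]
      simp only [map_smul]
      change (ContMDiffMap.const (u none) : SmoothFun E M) • (0 : VecField E M)
        + ∑ i, (ContMDiffMap.const (u (some i)) : SmoothFun E M) • T.cutoff • X i = _
      rw [smul_zero, zero_add]
    -- The symbol sees only the horizontal coefficients; the jet of the generator then detects that
    -- of the identity.
    have hsome : ∀ i, u (some i) = 0 := fun i => by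
      have e := ha0 i _ (DL.symbol_eq_zero hψ)
      rw [hD] at e
      simp only [map_sum, map_smul, sum_fun_apply, smul_eq_mul, ContMDiffMap.coe_mul,
        Pi.mul_apply, T.cutoff_self, one_mul, ha1] at e
      simp only [mul_ite, mul_one, mul_zero, Finset.sum_ite_eq, Finset.mem_univ, if_true] at e
      exact e
    have hnone : u none = 0 := by
      have e := hu (jet T.gen)
      rw [Fintype.sum_option] at e
      simp only [hsome, zero_smul, Finset.sum_const_zero, add_zero] at e
      exact (smul_eq_zero.1 e).resolve_right T.gen_ne_zero
    funext j
    cases j with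
    | none => exact hnone
    | some i => exact hsome i

namespace ContactStructure

variable (C : ContactStructure E L)

/-- The form of a contact structure can be inverted locally, up to a smooth multiplier. -/
theorem exists_form_eq_smul (ψ : J1 E L) (x : M) :
    ∃ (D : DL E L) (f : SmoothFun E M), f x ≠ 0 ∧ C.form.flat D = f • ψ := by
  obtain ⟨T⟩ := nonempty_lineFrame E L x
  obtain ⟨n, κ, Fr, hκ, hFr, hind⟩ := exists_derivation_frame (E := E) (L := L) x
  let G : Matrix (Option (Fin n)) (Option (Fin n)) (SmoothFun E M) :=
    Matrix.of fun j l => T.coeff (C.form.flat (Fr j) (Fr l))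
  -- A null vector of the Gram matrix at `x`, extended with constant coefficients, would contradict
  -- pointwise nondegeneracy.
  have hdet : G.det x ≠ 0 := by
    intro h0
    let ev : SmoothFun E M →+* ℝ := ContMDiffMap.evalRingHom x
    have h1 : (ev.mapMatrix G).det = 0 := by rw [← RingHom.map_det]; exact h0
    obtain ⟨v, hv, hvG⟩ := Matrix.exists_vecMul_eq_zero_iff.2 h1
    let D : DL E L := ∑ j, (ContMDiffMap.const (v j) : SmoothFun E M) • Fr j
    have hD : ∀ ψ : J1 E L, ψ D x = ∑ j, v j • ψ (Fr j) x := fun ψ => by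
      simp only [D, map_sum, map_smul, sum_section_apply]
      rfl
    have hF : ∀ l, C.form.flat D (Fr l) x = 0 := fun l => by
      have e : ∑ j, v j * G j l x = 0 := congrFun hvG l
      have e1 := hD (C.form.flat (Fr l))
      rw [C.form.skew, ContMDiffSection.coe_neg, Pi.neg_apply, e1, neg_eq_zero]
      have e2 : ∀ j, v j • C.form.flat (Fr l) (Fr j) x = -((v j * G j l x) • T.gen x) := by
        intro j
        rw [C.form.skew, ContMDiffSection.coe_neg, Pi.neg_apply, T.apply_eq, smul_neg, smul_smul]
        rfl
      simp only [e2]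
      rw [Finset.sum_neg_distrib, ← Finset.sum_smul, e, zero_smul, neg_zero]
    have hzero : ∀ D', C.form.flat D D' x = 0 := fun D' => by
      obtain ⟨k, hk⟩ := hFr D'
      have e := congrArg (fun A => C.form.flat D A x) hk
      simp only [map_smul, map_sum, sum_section_apply, fun_smul_apply, hF, hκ, one_smul,
        smul_zero, Finset.sum_const_zero] at e
      exact e
    exact hv (hind v fun ψ => by rw [← hD, C.apply_eq_zero_of_form_eq_zero hzero])
  -- Cramer's rule without division: the adjugate exists over `C^∞(M)`, and the determinant remains
  -- as multiplier.
  let u := Matrix.vecMul (fun l => T.coeff (ψ (Fr l))) G.adjugate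
  have hu : ∀ l, ∑ j, u j * G j l = G.det * T.coeff (ψ (Fr l)) := fun l => by
    have e : Matrix.vecMul u G = G.det • fun l => T.coeff (ψ (Fr l)) := by
      rw [Matrix.vecMul_vecMul, Matrix.adjugate_mul, Matrix.vecMul_smul, Matrix.vecMul_one]
    exact congrFun e l
  let D : DL E L := ∑ j, u j • Fr j
  have hD : ∀ l, T.cutoff • C.form.flat D (Fr l) = (G.det * T.cutoff) • ψ (Fr l) := fun l => by
    have e : T.coeff (C.form.flat D (Fr l)) = G.det * T.coeff (ψ (Fr l)) := by
      rw [← hu]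
      simp only [D, map_sum, map_smul, LinearMap.sum_apply, LinearMap.smul_apply, smul_eq_mul]
      rfl
    rw [← T.coeff_smul, e, mul_smul, T.coeff_smul, smul_smul]
  -- The cutoff turns coefficients back into sections; `κ` lets an arbitrary `D'` be expanded in the
  -- frame.
  refine ⟨(T.cutoff * κ) • D, G.det * T.cutoff * κ, ?_, LinearMap.ext fun D' => ?_⟩
  · simpa only [ContMDiffMap.coe_mul, Pi.mul_apply, T.cutoff_self, hκ, mul_one] using hdet
  · obtain ⟨k, hk⟩ := hFr D'
    rw [map_smul, LinearMap.smul_apply, LinearMap.smul_apply, mul_smul, mul_smul _ κ,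
      ← map_smul (C.form.flat D), ← map_smul ψ, hk, map_sum (C.form.flat D), map_sum ψ,
      Finset.smul_sum, Finset.smul_sum]
    refine Finset.sum_congr rfl fun l _ => ?_
    rw [map_smul (C.form.flat D), map_smul ψ, smul_comm, hD, smul_comm]

/-- Injectivity is pointwise nondegeneracy, tested on jets and on symbols; surjectivity glues the
local solutions of Cramer's rule. -/
theorem bijective_form_flat : Function.Bijective C.form.flat := by
  have hinj : Function.Injective C.form.flat := by
    refine (injective_iff_map_eq_zero _).2 fun D hD => ?_
    have h : ∀ (ψ : J1 E L) (x : M), ψ D x = 0 := fun ψ x =>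
      C.apply_eq_zero_of_form_eq_zero (fun D' => by rw [hD]; rfl) ψ
    refine DL.ext' (fun s => ?_) ?_
    · ext x
      exact h (jet s) x
    · ext x
      exact DL.symbol_eq_zero fun ψ => h ψ x
  exact ⟨hinj, surjective_of_locally_surjective hinj C.exists_form_eq_smul⟩

end ContactStructure

end Inverse

/-! ### Block identities and the two constructions -/

section Correspondence

variable {E : Type*} [NormedAddCommGroup E] [NormedSpace ℝ E] [FiniteDimensional ℝ E]
  {M : Type*} [TopologicalSpace M] [ChartedSpace E M] [IsManifold 𝓘(ℝ, E) ∞ M]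
  {L : M → Type*} [TopologicalSpace (TotalSpace ℝ L)]
  [∀ x, AddCommGroup (L x)] [∀ x, Module ℝ (L x)] [∀ x, TopologicalSpace (L x)]
  [FiberBundle ℝ L] [VectorBundle ℝ ℝ L]

namespace GenContactStructure

variable (I : GenContactStructure E L)

theorem endo_inr (ψ : J1 E L) : I.endo (0, ψ) = (I.sharp ψ, -dagger I.phi ψ) := by
  rw [I.endo_apply, map_zero, map_zero, zero_add, zero_sub]

/-- Upper right block of `ℐ² = -id`. -/
theorem phi_sharp (ψ : J1 E L) : I.phi (I.sharp ψ) = I.sharp (dagger I.phi ψ) := by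
  have e := I.sq (0, ψ)
  rw [endo_inr, endo_apply] at e
  have e1 : I.phi (I.sharp ψ) + I.sharp (-dagger I.phi ψ) = -0 := congrArg Prod.fst e
  rw [map_neg, neg_zero, ← sub_eq_add_neg] at e1
  exact sub_eq_zero.1 e1

/-- Upper left block of `ℐ² = -id`; for invertible `J♯` it determines `ω`. -/
theorem sharp_omega (D : DL E L) : I.sharp (I.omega.flat D) = -(D + I.phi (I.phi D)) := by
  have e := I.sq (D, 0)
  rw [I.endo_apply D 0, map_zero, map_zero, add_zero, sub_zero, endo_apply] at e
  have e1 : I.phi (I.phi D) + I.sharp (I.omega.flat D) = -D := congrArg Prod.fst e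
  rw [neg_add, ← e1]
  abel

variable {I}

theorem omegaJ_sharp (h : I.NonDegenerate) (ψ : J1 E L) : (I.omegaJ h).flat (I.sharp ψ) = ψ :=
  h.1 (I.sharp_omegaJ h _)

theorem omegaJ_phi (h : I.NonDegenerate) :
    (I.omegaJ h).flat ∘ₗ I.phi = dagger I.phi ∘ₗ (I.omegaJ h).flat := by
  refine LinearMap.ext fun D => h.1 ?_
  rw [LinearMap.comp_apply, LinearMap.comp_apply, I.sharp_omegaJ, ← I.phi_sharp, I.sharp_omegaJ]

theorem omega_apply (h : I.NonDegenerate) (D D' : DL E L) : I.omega.flat D D' =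
    -((I.omegaJ h).flat D D' + (I.omegaJ h).flat (I.phi D) (I.phi D')) := by
  have e : I.omega.flat D = -((I.omegaJ h).flat D + dagger I.phi ((I.omegaJ h).flat (I.phi D))) := by
    refine h.1 ?_
    rw [I.sharp_omega, map_neg, map_add, ← I.phi_sharp, I.sharp_omegaJ, I.sharp_omegaJ]
  rw [e]
  rfl

/-- With nondegenerate `J`, the structure is determined by `ω_J` and `φ`. -/
theorem eq_of_omegaJ_eq {I' : GenContactStructure E L} (h : I.NonDegenerate)
    (h' : I'.NonDegenerate) (hJ : I.omegaJ h = I'.omegaJ h') (hφ : I.phi = I'.phi) : I = I' := by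
  have hs : I.sharp = I'.sharp := by
    refine LinearMap.ext fun ψ => ?_
    rw [← I'.sharp_omegaJ h' (I.sharp ψ), ← hJ, omegaJ_sharp]
  have ho : I.omega.flat = I'.omega.flat :=
    LinearMap.ext fun D => LinearMap.ext fun D' => by
      rw [omega_apply h, omega_apply h', hJ, hφ]
  refine GenContactStructure.ext (LinearMap.ext fun α => ?_)
  rw [← Prod.mk.eta (p := α), endo_apply, endo_apply, hs, ho, hφ]

theorem closed (h : I.NonDegenerate) :
    (∀ D₁ D₂ D₃, dTwo (I.omegaJ h) D₁ D₂ D₃ = 0) ∧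
      ∀ D₁ D₂ D₃, dTwo ((I.omegaJ h).twist I.phi (omegaJ_phi h)) D₁ D₂ D₃ = 0 :=
  (torsion_eq_zero_iff I.sq I.endo_inr (I.sharp_omegaJ h) (omegaJ_sharp h) (omegaJ_phi h)).1
    I.integrable

/-- The primitive `ω_J(𝟙, -)` kills the identity because `ω_J` is alternating, so it descends to a
contact form. -/
theorem exists_contact_form_eq [T2Space M] [ContMDiffVectorBundle ∞ ℝ L 𝓘(ℝ, E)]
    (h : I.NonDegenerate) : ∃ C : ContactStructure E L, C.form = I.omegaJ h := by
  have e := AtiyahTwoForm.eq_dOne (closed h).1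
  obtain ⟨C, hC⟩ := exists_contactStructure ((I.omegaJ h).alt DL.one)
    (by rw [← e]; exact fun ψ => ⟨_, omegaJ_sharp h ψ⟩)
  exact ⟨C, by rw [ContactStructure.form, hC, ← e]⟩

end GenContactStructure

/-- The generalized contact structure with prescribed `ω_J` and `φ`. -/
theorem exists_genContactStructure {w : AtiyahTwoForm E L}
    (hw : Function.Bijective w.flat) {Φ : DL E L →ₗ[SmoothFun E M] DL E L}
    (h : w.flat ∘ₗ Φ = dagger Φ ∘ₗ w.flat) (hc : ∀ D₁ D₂ D₃, dTwo w D₁ D₂ D₃ = 0)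
    (hc' : ∀ D₁ D₂ D₃, dTwo (w.twist Φ h) D₁ D₂ D₃ = 0) :
    ∃ (I : GenContactStructure E L) (hI : I.NonDegenerate), I.omegaJ hI = w ∧ I.phi = Φ := by
  let B := LinearEquiv.ofBijective w.flat hw
  let J : J1 E L →ₗ[SmoothFun E M] DL E L := B.symm.toLinearMap
  have hJw : ∀ D, J (w.flat D) = D := B.symm_apply_apply
  have hwJ : ∀ ψ, w.flat (J ψ) = ψ := B.apply_symm_apply
  have hΦ : ∀ D, w.flat (Φ D) = dagger Φ (w.flat D) := AtiyahTwoForm.flat_comp_apply h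
  have hΦJ : ∀ ψ, J (dagger Φ ψ) = Φ (J ψ) := fun ψ => by
    rw [← hJw (Φ (J ψ)), hΦ, hwJ]
  -- The lower left block `-w♭(id + Φ²)` is the only one compatible with `I² = -id`.
  let I : OmniDL E L →ₗ[SmoothFun E M] OmniDL E L :=
    (Φ ∘ₗ LinearMap.fst _ _ _ + J ∘ₗ LinearMap.snd _ _ _).prod
      (-(w.flat ∘ₗ (LinearMap.id + Φ ∘ₗ Φ)) ∘ₗ LinearMap.fst _ _ _
        - dagger Φ ∘ₗ LinearMap.snd _ _ _)
  have hI : ∀ D ψ, I (D, ψ) = (Φ D + J ψ, -w.flat (D + Φ (Φ D)) - dagger Φ ψ) := fun _ _ => rfl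
  have hsq : ∀ α, I (I α) = -α := by
    rintro ⟨D, ψ⟩
    rw [hI, hI]
    refine Prod.ext ?_ ?_
    · change Φ (Φ D + J ψ) + J (-w.flat (D + Φ (Φ D)) - dagger Φ ψ) = -D
      rw [map_sub, map_neg, hJw, hΦJ, map_add]
      abel
    · change -w.flat (Φ D + J ψ + Φ (Φ (Φ D + J ψ)))
        - dagger Φ (-w.flat (D + Φ (Φ D)) - dagger Φ ψ) = -ψ
      simp only [map_add, map_sub, map_neg, hΦ, hwJ]
      abel
  have hinr : ∀ ψ, I (0, ψ) = (J ψ, -dagger Φ ψ) := fun ψ => by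
    rw [hI]
    simp only [map_zero, zero_add, neg_zero, zero_sub]
  have hskew : ∀ α β, pairing (I α) β = -pairing α (I β) := by
    rintro ⟨D, ψ⟩ ⟨D', ψ'⟩
    have e1 : ψ' (J ψ) = -ψ (J ψ') := by
      rw [← hwJ ψ, ← hwJ ψ', w.skew]
      simp only [hJw]
    -- Moving one `Φ` across turns each side into `w(ΦD, ΦD')` up to sign.
    have e2 : w.flat (Φ (Φ D)) D' = -w.flat (Φ (Φ D')) D := by
      rw [hΦ, hΦ (Φ D'), dagger_apply, dagger_apply, w.skew]
    rw [hI, hI]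
    simp only [pairing, map_add, LinearMap.sub_apply, LinearMap.neg_apply, LinearMap.add_apply,
      dagger_apply, e1, e2, w.skew D D']
    abel
  let S : GenContactStructure E L := ⟨I, hsq, hskew,
    (torsion_eq_zero_iff hsq hinr hJw hwJ h).2 ⟨hc, hc'⟩⟩
  have hsharp : S.sharp = J := LinearMap.ext fun ψ => congrArg Prod.fst (hinr ψ)
  have hS : S.NonDegenerate := by
    rw [GenContactStructure.NonDegenerate, hsharp]
    exact B.symm.bijective
  refine ⟨S, hS, AtiyahTwoForm.ext (LinearMap.ext fun D => hS.1 ?_), LinearMap.ext fun D => ?_⟩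
  · rw [S.sharp_omegaJ, hsharp, hJw]
  · change Φ D + J 0 = Φ D
    rw [map_zero, add_zero]

end Correspondence

end GenContact

/-! ### The bijection -/

theorem mainTheorem4
    {E : Type*} [NormedAddCommGroup E] [NormedSpace ℝ E] [FiniteDimensional ℝ E]
    {M : Type*} [TopologicalSpace M] [T2Space M] [SecondCountableTopology M]
    [ChartedSpace E M] [IsManifold 𝓘(ℝ, E) ∞ M]
    (L : M → Type*) [TopologicalSpace (TotalSpace ℝ L)]
    [∀ x, AddCommGroup (L x)] [∀ x, Module ℝ (L x)] [∀ x, TopologicalSpace (L x)]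
    [FiberBundle ℝ L] [VectorBundle ℝ ℝ L] [ContMDiffVectorBundle ∞ ℝ L 𝓘(ℝ, E)] :
    ∃ e : {I : GenContact.GenContactStructure E L // I.NonDegenerate} ≃
        GenContact.ContactHitchinPair E L,
      ∀ I, (e I).contact.form = I.1.omegaJ I.2 ∧
        (e I).Φ = I.1.phi ∧
        ∀ D D' : GenContact.DL E L, I.1.omega.flat D D' =
          -((I.1.omegaJ I.2).flat D D' + (I.1.omegaJ I.2).flat (I.1.phi D) (I.1.phi D')) := by
  have key : ∀ I : {I : GenContact.GenContactStructure E L // I.NonDegenerate},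
      ∃ P : GenContact.ContactHitchinPair E L,
        P.contact.form = I.1.omegaJ I.2 ∧ P.Φ = I.1.phi := by
    rintro ⟨I, hI⟩
    obtain ⟨C, hC⟩ := GenContact.GenContactStructure.exists_contact_form_eq hI
    refine ⟨⟨C, I.phi, by rw [hC, GenContact.GenContactStructure.omegaJ_phi], ?_⟩, hC, rfl⟩
    simp only [hC]
    exact (GenContact.GenContactStructure.closed hI).2
  choose f hf hΦ using key
  have hbij : Function.Bijective f := by
    refine ⟨fun I I' h => Subtype.ext ?_, fun P => ?_⟩
    · exact GenContact.GenContactStructure.eq_of_omegaJ_eq I.2 I'.2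
        (by rw [← hf, ← hf, h]) (by rw [← hΦ, ← hΦ, h])
    -- The form of a contact structure is exact, hence closed. The pair chosen for `I` must be `P`,
    -- as a contact structure is determined by its form.
    · obtain ⟨I, hI, hw, hφ⟩ := GenContact.exists_genContactStructure
        P.contact.bijective_form_flat P.compat (GenContact.dTwo_dOne _) P.closed
      exact ⟨⟨I, hI⟩, GenContact.ContactHitchinPair.ext
        (GenContact.ContactStructure.form_injective ((hf _).trans hw)) ((hΦ _).trans hφ)⟩
  exact ⟨Equiv.ofBijective f hbij, fun I =>
    ⟨hf I, hΦ I, GenContact.GenContactStructure.omega_apply I.2⟩⟩
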